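/- **Poincaré inequality with zero boundary average.** Let $d\in\{2,3\}$. A *polytopal element* $K\subset\mathbb R^d$ is a polygon ($d=2$) or polyhedron ($d=3$), not necessarily convex: a finite union of convex polytopes that is the closure of its non-empty connected interior, whose boundary does not intersect itself (it is a topological $(d-1)$-manifold) and is the union of a finite set $\mathcal F(K)$ of closed flat $(d-1)$-dimensional polytopal faces with connected, pairwise disjoint relative interiors; neighbouring faces may be coplanar. Put $n_K=|\mathcal F(K)|$, let $h_D$ be the diameter of a set $D$, and let $\operatorname{conv}(K)$ be the convex hull of $K$. For a face $F$ of $K$ with unit normal $\boldsymbol n$ pointing into $K$, a set $G\subseteq F$ and $I\subseteq\mathbb R$, write $G\times I=\{\boldsymbol x+\tau\boldsymbol n:\boldsymbol x\in G,\tau\in I\}$, and set $$\delta_G=\inf\{\tau>0: K\cap(G\times(\tau,\infty))=\varnothing\},\qquad P(G,\boldsymbol p)=\{(1-t)\boldsymbol x+t\boldsymbol p:\ \boldsymbol x\in G,\ t\in(0,1)\},$$ $$l_G=\sup\{l>0:\ \exists\,\boldsymbol p\in\mathbb R^d,\ \operatorname{dist}(\boldsymbol p,G)=l,\ P(G,\boldsymbol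 p)\subseteq K\cap(G\times(0,\delta_G])\}$$ (with $l_G=0$ if there is no such $l$). Let $N,M\in\mathbb N$ and $\gamma>0$, and consider the conditions * **(A)** $n_K\le N$; * **(B)** (height condition) every face $F\in\mathcal F(K)$ is the union of at most $M$ measurable pieces $F_\beta$, pairwise overlapping only in sets of surface measure zero, such that $l_{F_\beta}\ge\gamma\, h_F$ for every $\beta$. Then there is a constant $C>0$ depending only on $d,N,M,\gamma$ such that for every polytopal element $K\subset\mathbb R^d$ satisfying (A) and (B) and every real-valued $v\in H^1(\operatorname{conv}(K))$, the function $v$ has a trace in $L^2(\partial K)$ and $$\big\|v-\overline v^{\,\partial K}\big\|_{L^2(K)}\ \le\ C\,h_K\,\|\nabla v\|_{L^2(\operatorname{conv}(K))},\qquad \overline v^{\,\partial K}=\frac1{|\partial K|}\int_{\partial K}v\,\mathrm dS .$$ Here $H^1(\operatorname{conv}(K))$ is the space of square-integrable functions with square-integrable weak gradient on the interior of $\operatorname{conv}(K)$. A trace of $v$ on $\partial K$ is a limit in $L^2(\partial K)$ of $\varphi_n|_{\partial K}$ for some smooth functions $\varphi_n$ on $\mathbb R^d$ with $\varphi_n\to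 v$ in $H^1(\operatorname{conv}(K))$; the inequality holds with $\overline v^{\,\partial K}$ computed from any such trace. -/

import Mathlib

open MeasureTheory Filter Topology Set

noncomputable section

namespace Polytopal

/-- `d`-dimensional Euclidean space. -/
abbrev E (d : ℕ) : Type := EuclideanSpace ℝ (Fin d)

/-! ### Polytopes -/

/-- A (closed, bounded, not necessarily convex) flat polytopal region of dimension `k` in `ℝᵈ`:
a finite union of convex hulls of finite sets whose affine span has dimension `k`, which is the
closure of its relative interior, the relative interior being connected (and non-empty).
For `k = d` the relative interior is the interior. -/
structure IsPolytopalRegion {d : ℕ} (k : ℕ) (S : Set (E d)) : Prop where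
  finite_union : ∃ P : Finset (Finset (E d)), S = ⋃ s ∈ P, convexHull ℝ (s : Set (E d))
  finrank_span : Module.finrank ℝ (affineSpan ℝ S).direction = k
  closure_interior : closure (intrinsicInterior ℝ S) = S
  connected : IsConnected (intrinsicInterior ℝ S)

/-- A polygon (`d = 2`) or polyhedron (`d = 3`) without self-intersections, together with the
finite list of its `(d-1)`-dimensional flat faces. Neighbouring faces may lie in the same
hyperplane, as happens for elements of a mesh with hanging nodes. -/
structure Polytope (d : ℕ) where
  /-- the closed polytope as a set of points -/
  carrier : Set (E d)
  region : IsPolytopalRegion d carrier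
  /-- the boundary does not intersect itself: it is a topological `(d-1)`-manifold -/
  simple : ∀ x ∈ frontier carrier, ∃ U : Set (E d), IsOpen U ∧ x ∈ U ∧
    Nonempty (↥(frontier carrier ∩ U) ≃ₜ E (d - 1))
  /-- the flat faces -/
  faces : Finset (Set (E d))
  face_region : ∀ F ∈ faces, IsPolytopalRegion (d - 1) F
  face_disjoint : ∀ F ∈ faces, ∀ G ∈ faces, F ≠ G →
    Disjoint (intrinsicInterior ℝ F) (intrinsicInterior ℝ G)
  iUnion_faces : ⋃ F ∈ faces, F = frontier carrier

/-- `(d-1)`-dimensional surface measure, normalised to be Lebesgue measure on hyperplanes. -/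
def surfaceMeasure (d : ℕ) : Measure (E d) := Measure.euclideanHausdorffMeasure (d - 1)

/-- `n` is the unit normal of the face `F` of `K` pointing into `K`. -/
structure IsInwardNormal {d : ℕ} (K F : Set (E d)) (n : E d) : Prop where
  norm_eq_one : ‖n‖ = 1
  orthogonal : ∀ u ∈ (affineSpan ℝ F).direction, inner ℝ n u = 0
  inward : ∀ x ∈ intrinsicInterior ℝ F,
    ∀ᶠ t : ℝ in 𝓝[>] 0, x + t • n ∈ interior K ∧ x - t • n ∉ K

/-- The prism `F × I` over `F`, in the coordinate system whose last axis is directed by `n`. -/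
def prism {d : ℕ} (F : Set (E d)) (n : E d) (I : Set ℝ) : Set (E d) :=
  {y | ∃ x ∈ F, ∃ τ ∈ I, y = x + τ • n}

/-- `δ_F = inf {τ > 0 : K ∩ (F × (τ, ∞)) = ∅}`. -/
def depth {d : ℕ} (K F : Set (E d)) (n : E d) : ℝ :=
  sInf {τ : ℝ | 0 < τ ∧ K ∩ prism F n (Ioi τ) = ∅}

/-- The pyramid with base `F` and apex `p`. -/
def pyramid {d : ℕ} (F : Set (E d)) (p : E d) : Set (E d) :=
  {y | ∃ x ∈ F, ∃ t ∈ Ioo (0 : ℝ) 1, y = (1 - t) • x + t • p}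

/-- The heights of the pyramids with base `F` that are contained in `K ∩ (F × (0, δ_F])`. -/
def heightSet {d : ℕ} (K F : Set (E d)) (n : E d) : Set ℝ :=
  {l | 0 < l ∧ ∃ p : E d, Metric.infDist p F = l ∧
    pyramid F p ⊆ K ∩ prism F n (Ioc 0 (depth K F n))}

/-- The inward height `l_F`: the supremum of the heights of these pyramids. -/
def inwardHeight {d : ℕ} (K F : Set (E d)) (n : E d) : ℝ := sSup (heightSet K F n)

/-- The height condition with constants `γ` and `M`: every face `F` has a partition into at most
`M` pieces (up to overlaps of surface measure zero), each of which has inward height at least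
`γ h_F`, where `h_F` is the diameter of the whole face. -/
def HeightCondition {d : ℕ} (K : Polytope d) (γ : ℝ) (M : ℕ) : Prop :=
  ∀ F ∈ K.faces, ∃ n : E d, IsInwardNormal K.carrier F n ∧
    ∃ B : Finset (Set (E d)), B.card ≤ M ∧ ⋃ G ∈ B, G = F ∧
      (∀ G ∈ B, MeasurableSet G) ∧
      (∀ G ∈ B, ∀ G' ∈ B, G ≠ G' → surfaceMeasure d (G ∩ G') = 0) ∧
      ∀ G ∈ B, γ * Metric.diam F ≤ inwardHeight K.carrier G n

/-! ### Sobolev functions and their traces -/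

/-- `v ∈ H¹(D)` with weak gradient `g` (`D` open): both are square integrable on `D` and
`∫ v ∇φ = - ∫ φ g` for all test functions `φ ∈ C_c^∞(D)`. -/
structure IsH1 {d : ℕ} (D : Set (E d)) (v : E d → ℝ) (g : E d → E d) : Prop where
  memLp : MemLp v 2 (volume.restrict D)
  memLp_grad : MemLp g 2 (volume.restrict D)
  weak_grad : ∀ φ : E d → ℝ, ContDiff ℝ ((⊤ : ℕ∞) : WithTop ℕ∞) φ → HasCompactSupport φ →
    tsupport φ ⊆ D → ∫ x in D, v x • gradient φ x = - ∫ x in D, φ x • g x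

/-- The interior of the convex hull of `K`. It differs from the convex hull by a null set. -/
def hull {d : ℕ} (K : Polytope d) : Set (E d) := interior (convexHull ℝ K.carrier)

/-- Surface measure on the boundary of `K`. -/
def boundaryMeasure {d : ℕ} (K : Polytope d) : Measure (E d) :=
  (surfaceMeasure d).restrict (frontier K.carrier)

/-- `w ∈ L²(∂K)` is the trace on `∂K` of `v ∈ H¹(conv K)`, `∇v = g`: the trace is the continuous
extension to `H¹(conv K)` of the restriction of smooth functions to `∂K`, that is, there are
smooth `φₙ` with `φₙ → v` in `H¹(conv K)` and `φₙ → w` in `L²(∂K)`. -/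
def IsTrace {d : ℕ} (K : Polytope d) (v : E d → ℝ) (g : E d → E d) (w : E d → ℝ) : Prop :=
  MemLp w 2 (boundaryMeasure K) ∧
  ∃ φ : ℕ → E d → ℝ, (∀ n, ContDiff ℝ ((⊤ : ℕ∞) : WithTop ℕ∞) (φ n)) ∧
    Tendsto (fun n => eLpNorm (fun x => φ n x - v x) 2 (volume.restrict (hull K))) atTop (𝓝 0) ∧
    Tendsto (fun n => eLpNorm (fun x => gradient (φ n) x - g x) 2 (volume.restrict (hull K)))
      atTop (𝓝 0) ∧
    Tendsto (fun n => eLpNorm (fun x => φ n x - w x) 2 (boundaryMeasure K)) atTop (𝓝 0)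

end Polytopal

end

/-
Let `n` be the normal of a face `F` of `K`. The oscillation `∫_K ∫_F |φ(x) - φ(y)|²` of a smooth
`φ` is estimated by going from `x` to `y` through an intermediate point `a` of `K` whose distance
to the plane of `F` is at least `s = |K| / (4 |∂K|)`. Such points fill at least half of `K`:
projecting onto the plane of `F` is 1-Lipschitz and maps `∂K` onto the projection of `K`, so the
part of `K` at distance less than `s` from that plane has volume at most `2 s |∂K|`.
On each of the two segments ending at `a`, the fundamental theorem of calculus and a change of
variables on each half of the segment bound the increment of `φ` by the energy of `φ` on the convex
hull of `K`; for the half next to `F` the Jacobian contains the distance of `a` to the plane, which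
is where `s` enters. Since `s` is a multiple of `|K| / |∂K|`, no shape parameter survives after
summing over the faces.
Contracting towards an interior point and mollifying shows that smooth functions are dense in `H¹`
of the convex hull, and both the trace and the inequality pass to the limit.
-/

open scoped ENNReal

noncomputable section

namespace Polytopal

section ChangeOfVariables

variable {V : Type*} [NormedAddCommGroup V] [NormedSpace ℝ V] [FiniteDimensional ℝ V]
  [MeasurableSpace V] [BorelSpace V] (μ : Measure V) [μ.IsAddHaarMeasure]

lemma lintegral_comp_smul_add (f : V → ℝ≥0∞) {r : ℝ} (hr : r ≠ 0) (b : V) :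
    ∫⁻ x, f (r • x + b) ∂μ = ENNReal.ofReal |(r ^ Module.finrank ℝ V)⁻¹| * ∫⁻ x, f x ∂μ := by
  have hmap := lintegral_map_equiv (μ := μ) (fun x => f (x + b))
    (Homeomorph.smulOfNeZero r hr).toMeasurableEquiv
  have hscale : Measure.map (Homeomorph.smulOfNeZero r hr).toMeasurableEquiv μ
      = ENNReal.ofReal |(r ^ Module.finrank ℝ V)⁻¹| • μ := Measure.map_addHaar_smul μ hr
  rw [hscale, lintegral_smul_measure, lintegral_add_right_eq_self] at hmap
  exact hmap.symm

lemma lintegral_comp_smul_add_le (f : V → ℝ≥0∞) {r : ℝ} (hr : 1 / 2 ≤ r) (b : V) :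
    ∫⁻ x, f (r • x + b) ∂μ ≤ 2 ^ Module.finrank ℝ V * ∫⁻ x, f x ∂μ := by
  have hr0 : 0 < r := by linarith
  rw [lintegral_comp_smul_add μ f hr0.ne', abs_of_pos (by positivity), ← inv_pow,
    ENNReal.ofReal_pow (by positivity)]
  gcongr
  rw [← ENNReal.ofReal_ofNat]
  exact ENNReal.ofReal_le_ofReal (by rw [inv_le_comm₀ hr0 two_pos]; linarith)

end ChangeOfVariables

/-! ### Hyperplanes and surface measure -/

section Hyperplane

variable {V : Type*} [NormedAddCommGroup V] [InnerProductSpace ℝ V]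

/-- The hyperplane through `q` with normal `n`. -/
def hyperplane (q n : V) : Set V := {x | inner ℝ n (x - q) = 0}

/-- Coordinates with origin `q`, one axis along `n` and the other ones in the hyperplane
`n^⊥`, so that `hyperplane q n` is the set of the points with first coordinate `0`. -/
def hyperplaneCoord (q n : V) (p : ℝ × (ℝ ∙ n)ᗮ) : V := p.1 • n + p.2 + q

lemma inner_hyperplaneCoord_sub (q : V) {n : V} (hn : ‖n‖ = 1) (p : ℝ × (ℝ ∙ n)ᗮ) :
    inner ℝ n (hyperplaneCoord q n p - q) = p.1 := by
  have hp : inner ℝ n (p.2 : V) = 0 := Submodule.mem_orthogonal_singleton_iff_inner_right.1 p.2.2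
  simp [hyperplaneCoord, inner_add_right, inner_smul_right, hp, hn]

lemma orthogonalProjectionOnto_smul_self_eq_zero (n : V) (t : ℝ) :
    (ℝ ∙ n)ᗮ.orthogonalProjectionOnto (t • n) = 0 :=
  Submodule.orthogonalProjectionOnto_orthogonal_apply_eq_zero
    (Submodule.smul_mem _ t (Submodule.mem_span_singleton_self n))

lemma orthogonalProjectionOnto_hyperplaneCoord_sub (q n : V) (p : ℝ × (ℝ ∙ n)ᗮ) :
    (ℝ ∙ n)ᗮ.orthogonalProjectionOnto (hyperplaneCoord q n p - q) = p.2 := by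
  rw [hyperplaneCoord, add_sub_cancel_right, map_add, orthogonalProjectionOnto_smul_self_eq_zero,
    zero_add, Submodule.orthogonalProjectionOnto_mem_subspace_eq_self]

lemma range_coe_add_eq_hyperplane (q n : V) :
    range (fun y : (ℝ ∙ n)ᗮ => (y : V) + q) = hyperplane q n := by
  ext x
  refine ⟨?_, fun hx => ⟨⟨x - q, ?_⟩, sub_add_cancel x q⟩⟩
  · rintro ⟨y, rfl⟩
    simpa [hyperplane] using Submodule.mem_orthogonal_singleton_iff_inner_right.1 y.2
  · exact Submodule.mem_orthogonal_singleton_iff_inner_right.2 hx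

lemma isometry_coe_add (q : V) (W : Submodule ℝ V) : Isometry fun y : W => (y : V) + q :=
  (IsometryEquiv.addRight q).isometry.comp isometry_subtype_coe

lemma exists_hyperplaneCoord_eq (q : V) {n : V} (hn : ‖n‖ = 1) (a : V) :
    ∃ y : (ℝ ∙ n)ᗮ, hyperplaneCoord q n (inner ℝ n (a - q), y) = a := by
  refine ⟨⟨a - q - inner ℝ n (a - q) • n, ?_⟩, ?_⟩
  · rw [Submodule.mem_orthogonal_singleton_iff_inner_right]
    simp [inner_sub_right, inner_smul_right, hn]
  · simp [hyperplaneCoord]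

lemma exists_add_smul_mem_frontier {K : Set V} (hK : IsCompact K) {x : V} (hx : x ∈ K) {n : V}
    (hn : n ≠ 0) : ∃ τ : ℝ, x + τ • n ∈ frontier K := by
  have hline : IsClosedEmbedding fun τ : ℝ => x + τ • n :=
    (Homeomorph.addLeft x).isClosedEmbedding.comp (isClosedEmbedding_smul_left hn)
  obtain ⟨τ, hτ⟩ := nonempty_frontier_iff.2
    ⟨⟨0, by simpa using hx⟩, (hline.isCompact_preimage hK).ne_univ⟩
  exact ⟨τ, hline.continuous.frontier_preimage_subset K hτ⟩

variable [FiniteDimensional ℝ V]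

lemma finrank_orthogonal_span_singleton {n : V} (hn : n ≠ 0) :
    Module.finrank ℝ (ℝ ∙ n)ᗮ = Module.finrank ℝ V - 1 := by
  rw [← (ℝ ∙ n).finrank_add_finrank_orthogonal, finrank_span_singleton hn, Nat.add_sub_cancel_left]

lemma measurePreserving_hyperplaneCoord [MeasurableSpace V] [BorelSpace V] (q : V) {n : V}
    (hn : ‖n‖ = 1) : MeasurePreserving (hyperplaneCoord q n) volume volume := by
  have hsplit := ((ℝ ∙ n).measurePreserving_measurableEquivProd q).symm
  rw [InnerProductSpace.euclideanHausdorffMeasure_eq_volume] at hsplit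
  have hcomp := hsplit.comp
    ((LinearIsometryEquiv.toSpanUnitSingleton (𝕜 := ℝ) n hn).measurePreserving.prod
      (MeasurePreserving.id (volume : Measure (ℝ ∙ n)ᗮ)))
  have heq : hyperplaneCoord q n = ((ℝ ∙ n).measurableEquivProd q).symm ∘
      Prod.map (LinearIsometryEquiv.toSpanUnitSingleton (𝕜 := ℝ) n hn) id := by
    ext1 p
    simp [hyperplaneCoord]
  rw [heq]
  exact hcomp

end Hyperplane

section SurfaceMeasure

variable {d : ℕ}

lemma map_volume_hyperplane (q : E d) {n : E d} (hn : ‖n‖ = 1) :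
    Measure.map (fun y : (ℝ ∙ n)ᗮ => (y : E d) + q) volume
      = (surfaceMeasure d).restrict (hyperplane q n) := by
  have hrank := finrank_orthogonal_span_singleton (norm_ne_zero_iff.1 (hn ▸ one_ne_zero))
  rw [finrank_euclideanSpace_fin] at hrank
  rw [← InnerProductSpace.euclideanHausdorffMeasure_eq_volume, hrank,
    (isometry_coe_add q _).map_euclideanHausdorffMeasure, range_coe_add_eq_hyperplane]
  rfl

lemma surfaceMeasure_lt_top_of_subset_hyperplane {F : Set (E d)} (hF : IsCompact F) {q n : E d}
    (hn : ‖n‖ = 1) (hFn : F ⊆ hyperplane q n) : surfaceMeasure d F < ⊤ := by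
  have hemb := (isometry_coe_add q (ℝ ∙ n)ᗮ).isClosedEmbedding
  rw [← Measure.restrict_eq_self _ hFn, ← map_volume_hyperplane q hn,
    hemb.measurableEmbedding.map_apply]
  exact (hemb.isCompact_preimage hF).measure_lt_top

lemma surfaceMeasure_image_le {W : Type*} [EMetricSpace W] [MeasurableSpace W] [BorelSpace W]
    {f : E d → W} (hf : LipschitzWith 1 f) (S : Set (E d)) :
    Measure.euclideanHausdorffMeasure (d - 1) (f '' S) ≤ surfaceMeasure d S := by
  simp only [surfaceMeasure, Measure.euclideanHausdorffMeasure_def, Measure.smul_apply]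
  gcongr
  simpa using hf.hausdorffMeasure_image_le (d := (d - 1 : ℕ)) (by positivity) S

/-- Each line along `n` that meets `K` also meets its boundary, which thus has the same
projection. -/
lemma volume_projection_le_surfaceMeasure_frontier {K : Set (E d)} (hK : IsCompact K) (q : E d)
    {n : E d} (hn : n ≠ 0) :
    volume ((fun x => (ℝ ∙ n)ᗮ.orthogonalProjectionOnto (x - q)) '' K)
      ≤ surfaceMeasure d (frontier K) := by
  set f : E d → (ℝ ∙ n)ᗮ := fun x => (ℝ ∙ n)ᗮ.orthogonalProjectionOnto (x - q)
  have hlip : LipschitzWith 1 f := by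
    rw [← mul_one 1]
    exact (ℝ ∙ n)ᗮ.lipschitzWith_orthogonalProjectionOnto.comp
      (IsometryEquiv.subRight q).isometry.lipschitz
  have hsub : f '' K ⊆ f '' frontier K := by
    rintro _ ⟨x, hx, rfl⟩
    obtain ⟨τ, hτ⟩ := exists_add_smul_mem_frontier hK hx hn
    refine ⟨_, hτ, ?_⟩
    simp only [f, add_sub_right_comm, map_add, orthogonalProjectionOnto_smul_self_eq_zero, add_zero]
  refine (measure_mono hsub).trans ?_
  rw [← InnerProductSpace.euclideanHausdorffMeasure_eq_volume, finrank_orthogonal_span_singleton hn,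
    finrank_euclideanSpace_fin]
  exact surfaceMeasure_image_le hlip _

lemma volume_inter_slab_le {K : Set (E d)} (hK : IsCompact K) (q : E d) {n : E d} (hn : ‖n‖ = 1)
    (s : ℝ) :
    volume (K ∩ {x | |inner ℝ n (x - q)| < s})
      ≤ ENNReal.ofReal (2 * s) * surfaceMeasure d (frontier K) := by
  have hmeas : MeasurableSet (K ∩ {x | |inner ℝ n (x - q)| < s}) :=
    hK.measurableSet.inter (isOpen_lt (by fun_prop) continuous_const).measurableSet
  have hsub : hyperplaneCoord q n ⁻¹' (K ∩ {x | |inner ℝ n (x - q)| < s})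
      ⊆ Ioo (-s) s ×ˢ ((fun x => (ℝ ∙ n)ᗮ.orthogonalProjectionOnto (x - q)) '' K) := by
    rintro p ⟨hpK, hps⟩
    rw [mem_ofPred_eq, inner_hyperplaneCoord_sub q hn] at hps
    exact ⟨abs_lt.1 hps, _, hpK, orthogonalProjectionOnto_hyperplaneCoord_sub q n p⟩
  rw [← (measurePreserving_hyperplaneCoord q hn).measure_preimage hmeas.nullMeasurableSet]
  refine (measure_mono hsub).trans ?_
  rw [Measure.volume_eq_prod, Measure.prod_prod, Real.volume_Ioo, sub_neg_eq_add, ← two_mul]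
  gcongr
  exact volume_projection_le_surfaceMeasure_frontier hK q (norm_ne_zero_iff.1 (hn ▸ one_ne_zero))

lemma surfaceMeasure_frontier_ne_zero [NeZero d] {K : Set (E d)} (hK : IsCompact K)
    (hK0 : volume K ≠ 0) : surfaceMeasure d (frontier K) ≠ 0 := by
  intro h0
  obtain ⟨n, hn⟩ : ∃ n : E d, ‖n‖ = 1 := ⟨EuclideanSpace.single 0 1, by simp⟩
  obtain ⟨R, hR⟩ := hK.isBounded.exists_norm_le
  have hslab : K ⊆ {x | |inner ℝ n (x - 0)| < R + 1} := fun x hx => by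
    have := abs_real_inner_le_norm n x
    rw [hn, one_mul] at this
    simp only [sub_zero, mem_ofPred_eq]
    linarith [hR x hx]
  have hvol := volume_inter_slab_le hK 0 hn (R + 1)
  rw [inter_eq_self_of_subset_left hslab, h0, mul_zero, nonpos_iff_eq_zero] at hvol
  exact hK0 hvol

end SurfaceMeasure

/-! ### Mean squared oscillation -/

section SquareIntegrals

variable {α G : Type*} [MeasurableSpace α] [NormedAddCommGroup G]

lemma eLpNorm_two_sq (μ : Measure α) (f : α → G) : eLpNorm f 2 μ ^ 2 = ∫⁻ x, ‖f x‖ₑ ^ 2 ∂μ := by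
  simpa using eLpNorm_nnreal_pow_eq_lintegral (μ := μ) (f := f) (p := 2) two_ne_zero

lemma sq_lintegral_enorm_le {μ : Measure α} [IsProbabilityMeasure μ] {f : α → G}
    (hf : AEStronglyMeasurable f μ) : (∫⁻ x, ‖f x‖ₑ ∂μ) ^ 2 ≤ ∫⁻ x, ‖f x‖ₑ ^ 2 ∂μ := by
  rw [← eLpNorm_two_sq, ← eLpNorm_one_eq_lintegral_enorm]
  gcongr
  exact eLpNorm_le_eLpNorm_of_exponent_le one_le_two hf

lemma enorm_integral_sq_le [NormedSpace ℝ G] {μ : Measure α} [IsProbabilityMeasure μ] {f : α → G}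
    (hf : AEStronglyMeasurable f μ) : ‖∫ x, f x ∂μ‖ₑ ^ 2 ≤ ∫⁻ x, ‖f x‖ₑ ^ 2 ∂μ :=
  (pow_le_pow_left' (enorm_integral_le_lintegral_enorm f) 2).trans (sq_lintegral_enorm_le hf)

lemma measure_univ_mul_enorm_average_sq_le [NormedSpace ℝ G] {μ : Measure α} [IsFiniteMeasure μ]
    {f : α → G} (hf : AEStronglyMeasurable f μ) :
    μ univ * ‖⨍ x, f x ∂μ‖ₑ ^ 2 ≤ ∫⁻ x, ‖f x‖ₑ ^ 2 ∂μ := by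
  rcases eq_zero_or_neZero μ with rfl | hμ
  · simp
  have hjensen := enorm_integral_sq_le (hf.smul_measure (μ univ)⁻¹)
  rw [lintegral_smul_measure, smul_eq_mul] at hjensen
  calc μ univ * ‖⨍ x, f x ∂μ‖ₑ ^ 2 ≤ μ univ * ((μ univ)⁻¹ * ∫⁻ x, ‖f x‖ₑ ^ 2 ∂μ) := by
        gcongr
        exact hjensen
    _ = ∫⁻ x, ‖f x‖ₑ ^ 2 ∂μ := ENNReal.mul_inv_cancel_left (NeZero.ne _) (measure_ne_top μ _)

lemma enorm_add_sq_le (x y : G) : ‖x + y‖ₑ ^ 2 ≤ 2 * ‖x‖ₑ ^ 2 + 2 * ‖y‖ₑ ^ 2 := by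
  have hpow := ENNReal.rpow_add_le_mul_rpow_add_rpow ‖x‖ₑ ‖y‖ₑ one_le_two
  norm_num at hpow
  rw [← mul_add]
  exact (pow_le_pow_left' (enorm_add_le x y) 2).trans hpow

end SquareIntegrals

/-- The integral of `|φ(x) - φ(y)|²` with respect to `μ` in `x` and `ν` in `y`. -/
def sqOscillation {α : Type*} [MeasurableSpace α] (φ : α → ℝ) (μ ν : Measure α) : ℝ≥0∞ :=
  ∫⁻ x, ∫⁻ y, ‖φ x - φ y‖ₑ ^ 2 ∂ν ∂μ

section Oscillation

variable {α : Type*} [MeasurableSpace α] {φ : α → ℝ}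

lemma sqOscillation_comm (hφ : Measurable φ) (μ ν : Measure α) [SFinite μ] [SFinite ν] :
    sqOscillation φ μ ν = sqOscillation φ ν μ := by
  rw [sqOscillation, lintegral_lintegral_swap (by fun_prop)]
  simp_rw [sqOscillation, enorm_sub_rev]

lemma measure_univ_mul_sqOscillation_le (hφ : Measurable φ) (μ ν ρ : Measure α) [SFinite μ]
    [SFinite ν] [SFinite ρ] :
    ρ univ * sqOscillation φ μ ν
      ≤ 2 * ν univ * sqOscillation φ μ ρ + 2 * μ univ * sqOscillation φ ρ ν := by
  have hmeas : Measurable fun p : α × α => ‖φ p.1 - φ p.2‖ₑ ^ 2 := by fun_prop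
  have hright (τ : Measure α) [SFinite τ] : Measurable fun x => ∫⁻ y, ‖φ x - φ y‖ₑ ^ 2 ∂τ :=
    hmeas.lintegral_prod_right'
  have hpoint (x y : α) : ρ univ * ‖φ x - φ y‖ₑ ^ 2
      ≤ 2 * (∫⁻ a, ‖φ x - φ a‖ₑ ^ 2 ∂ρ) + 2 * ∫⁻ a, ‖φ y - φ a‖ₑ ^ 2 ∂ρ := by
    rw [mul_comm, ← lintegral_const, ← lintegral_const_mul _ (by fun_prop),
      ← lintegral_const_mul _ (by fun_prop), ← lintegral_add_left (by fun_prop)]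
    refine lintegral_mono fun a => ?_
    rw [enorm_sub_rev (φ y), ← sub_add_sub_cancel (φ x) (φ a) (φ y)]
    exact enorm_add_sq_le _ _
  calc ρ univ * sqOscillation φ μ ν
      = ∫⁻ x, ∫⁻ y, ρ univ * ‖φ x - φ y‖ₑ ^ 2 ∂ν ∂μ := by
        rw [sqOscillation, ← lintegral_const_mul _ (hright ν)]
        exact lintegral_congr fun x => (lintegral_const_mul _ (by fun_prop)).symm
    _ ≤ ∫⁻ x, ∫⁻ y, (2 * (∫⁻ a, ‖φ x - φ a‖ₑ ^ 2 ∂ρ) + 2 * ∫⁻ a, ‖φ y - φ a‖ₑ ^ 2 ∂ρ) ∂ν ∂μ :=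
        lintegral_mono fun x => lintegral_mono fun y => hpoint x y
    _ = ∫⁻ x, (2 * ν univ * (∫⁻ a, ‖φ x - φ a‖ₑ ^ 2 ∂ρ) + 2 * sqOscillation φ ν ρ) ∂μ := by
        refine lintegral_congr fun x => ?_
        rw [lintegral_add_left measurable_const, lintegral_const, lintegral_const_mul _ (hright ρ),
          sqOscillation]
        ring
    _ = 2 * ν univ * sqOscillation φ μ ρ + 2 * μ univ * sqOscillation φ ρ ν := by
        rw [lintegral_add_left ((hright ρ).const_mul _), lintegral_const,
          lintegral_const_mul _ (hright ρ), sqOscillation_comm hφ ν, sqOscillation, sqOscillation]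
        ring

lemma measure_univ_mul_lintegral_sub_average_sq_le (hφ : Measurable φ) (μ : Measure α)
    {ν : Measure α} [IsFiniteMeasure ν] (hint : Integrable φ ν) :
    ν univ * ∫⁻ x, ‖φ x - ⨍ y, φ y ∂ν‖ₑ ^ 2 ∂μ ≤ sqOscillation φ μ ν := by
  rcases eq_zero_or_neZero ν with rfl | hν
  · simp
  rw [← lintegral_const_mul _ (by fun_prop)]
  refine lintegral_mono fun x => ?_
  have haverage : φ x - ⨍ y, φ y ∂ν = ⨍ y, (φ x - φ y) ∂ν := by
    rw [average, average, integral_sub (integrable_const _) hint.to_average, integral_const]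
    simp
  rw [haverage]
  exact measure_univ_mul_enorm_average_sq_le (by fun_prop)

lemma measure_univ_mul_lintegral_sq_le (hφ : Measurable φ) (μ ν : Measure α) [SFinite ν] :
    μ univ * ∫⁻ y, ‖φ y‖ₑ ^ 2 ∂ν
      ≤ 2 * sqOscillation φ ν μ + 2 * ν univ * ∫⁻ x, ‖φ x‖ₑ ^ 2 ∂μ := by
  have hpoint (y : α) : μ univ * ‖φ y‖ₑ ^ 2
      ≤ 2 * (∫⁻ x, ‖φ y - φ x‖ₑ ^ 2 ∂μ) + 2 * ∫⁻ x, ‖φ x‖ₑ ^ 2 ∂μ := by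
    rw [mul_comm, ← lintegral_const, ← lintegral_const_mul _ (by fun_prop),
      ← lintegral_const_mul _ (by fun_prop), ← lintegral_add_left (by fun_prop)]
    refine lintegral_mono fun x => ?_
    simpa using enorm_add_sq_le (φ y - φ x) (φ x)
  calc μ univ * ∫⁻ y, ‖φ y‖ₑ ^ 2 ∂ν = ∫⁻ y, μ univ * ‖φ y‖ₑ ^ 2 ∂ν :=
        (lintegral_const_mul _ (by fun_prop)).symm
    _ ≤ ∫⁻ y, (2 * (∫⁻ x, ‖φ y - φ x‖ₑ ^ 2 ∂μ) + 2 * ∫⁻ x, ‖φ x‖ₑ ^ 2 ∂μ) ∂ν :=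
        lintegral_mono hpoint
    _ = 2 * sqOscillation φ ν μ + 2 * ν univ * ∫⁻ x, ‖φ x‖ₑ ^ 2 ∂μ := by
        rw [lintegral_add_right _ measurable_const, lintegral_const,
          lintegral_const_mul' _ _ (by finiteness), sqOscillation]
        ring

end Oscillation

/-! ### Integration along segments -/

section Segments

variable {V : Type*} [NormedAddCommGroup V] [InnerProductSpace ℝ V]

/-- The integral of `f` over the half of the segment `[y, a]` that contains `y`, parametrised
by `[0, 1/2]`. -/
def halfSegmentLIntegral (f : V → ℝ≥0∞) (a y : V) : ℝ≥0∞ :=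
  ∫⁻ t in Icc (0 : ℝ) (1 / 2), f (y + t • (a - y))

lemma lintegral_segment_le_add_halfSegmentLIntegral (f : V → ℝ≥0∞) (a y : V) :
    ∫⁻ t in Icc (0 : ℝ) 1, f (y + t • (a - y))
      ≤ halfSegmentLIntegral f a y + halfSegmentLIntegral f y a := by
  have hreverse : ∫⁻ t in Icc (1 / 2 : ℝ) 1, f (y + t • (a - y)) = halfSegmentLIntegral f y a := by
    rw [← (volume.measurePreserving_sub_left (1 : ℝ)).setLIntegral_comp_preimage_emb
      (MeasurableEquiv.subLeft (1 : ℝ)).measurableEmbedding, preimage_const_sub_Icc]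
    norm_num
    exact lintegral_congr fun t => by congr 1; module
  rw [← Icc_union_Icc_eq_Icc (b := (1 / 2 : ℝ)) (by norm_num) (by norm_num), ← hreverse]
  exact lintegral_union_le _ _ _

lemma enorm_gradient [CompleteSpace V] (φ : V → ℝ) (x : V) : ‖gradient φ x‖ₑ = ‖fderiv ℝ φ x‖ₑ :=
  (InnerProductSpace.toDual ℝ V).symm.enorm_map _

lemma enorm_sub_sq_le_lintegral_segment [CompleteSpace V] {φ : V → ℝ} (hφ : ContDiff ℝ 1 φ)
    (x y : V) :
    ‖φ x - φ y‖ₑ ^ 2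
      ≤ ‖x - y‖ₑ ^ 2 * ∫⁻ t in Icc (0 : ℝ) 1, ‖gradient φ (y + t • (x - y))‖ₑ ^ 2 := by
  have : IsProbabilityMeasure ((volume : Measure ℝ).restrict (Icc 0 1)) := ⟨by simp⟩
  set ψ : ℝ → ℝ := fun t => φ (y + t • (x - y))
  have hψ : ContDiff ℝ 1 ψ := by fun_prop
  have hderiv (t : ℝ) : ‖deriv ψ t‖ₑ ≤ ‖x - y‖ₑ * ‖gradient φ (y + t • (x - y))‖ₑ := by
    have hline : HasDerivAt (fun t : ℝ => y + t • (x - y)) (x - y) t := by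
      simpa using ((hasDerivAt_id t).smul_const (x - y)).const_add y
    have hchain : HasDerivAt ψ (fderiv ℝ φ (y + t • (x - y)) (x - y)) t :=
      (hφ.differentiable one_ne_zero _).hasFDerivAt.comp_hasDerivAt t hline
    rw [hchain.deriv, enorm_gradient, mul_comm]
    exact (fderiv ℝ φ _).le_opENorm (x - y)
  calc ‖φ x - φ y‖ₑ ^ 2 = ‖ψ 1 - ψ 0‖ₑ ^ 2 := by simp [ψ]
    _ ≤ (∫⁻ t in Icc (0 : ℝ) 1, ‖deriv ψ t‖ₑ) ^ 2 := by
        gcongr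
        exact enorm_sub_le_lintegral_deriv_of_contDiffOn_Icc hψ.contDiffOn zero_le_one
    _ ≤ ∫⁻ t in Icc (0 : ℝ) 1, ‖deriv ψ t‖ₑ ^ 2 :=
        sq_lintegral_enorm_le (hψ.continuous_deriv le_rfl).aestronglyMeasurable
    _ ≤ ∫⁻ t in Icc (0 : ℝ) 1, (‖x - y‖ₑ * ‖gradient φ (y + t • (x - y))‖ₑ) ^ 2 := by
        gcongr with t
        exact hderiv t
    _ = ‖x - y‖ₑ ^ 2 * ∫⁻ t in Icc (0 : ℝ) 1, ‖gradient φ (y + t • (x - y))‖ₑ ^ 2 := by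
        simp_rw [mul_pow]
        exact lintegral_const_mul' _ _ (by finiteness)

lemma enorm_sub_sq_le_halfSegmentLIntegral [CompleteSpace V] {φ : V → ℝ} (hφ : ContDiff ℝ 1 φ)
    {D : Set V} (hD : Convex ℝ D) {x y : V} (hx : x ∈ D) (hy : y ∈ D) :
    ‖φ x - φ y‖ₑ ^ 2 ≤ ‖x - y‖ₑ ^ 2 *
      (halfSegmentLIntegral (D.indicator fun z => ‖gradient φ z‖ₑ ^ 2) x y
        + halfSegmentLIntegral (D.indicator fun z => ‖gradient φ z‖ₑ ^ 2) y x) := by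
  refine (enorm_sub_sq_le_lintegral_segment hφ x y).trans ?_
  gcongr
  refine le_trans ?_ (lintegral_segment_le_add_halfSegmentLIntegral _ x y)
  refine setLIntegral_mono' measurableSet_Icc fun t ht => ?_
  rw [indicator_of_mem (hD.add_smul_sub_mem hy hx ht)]

lemma measurable_halfSegmentLIntegral [MeasurableSpace V] [BorelSpace V] [FiniteDimensional ℝ V]
    {f : V → ℝ≥0∞} (hf : Measurable f) :
    Measurable fun p : V × V => halfSegmentLIntegral f p.1 p.2 :=
  Measurable.lintegral_prod_right' (f := fun p : (V × V) × ℝ =>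
    f (p.1.2 + p.2 • (p.1.1 - p.1.2))) (by fun_prop)

variable [MeasurableSpace V]

/-- The integrals over the half segments between `a` and the points of `ν`, taken at the end of
these points, are bounded by `c` times the integral over the whole space. -/
def HalfSegmentBound [FiniteDimensional ℝ V] [BorelSpace V] (ν : Measure V) (a : V) (c : ℝ≥0∞) :
    Prop :=
  ∀ f : V → ℝ≥0∞, Measurable f → ∫⁻ y, halfSegmentLIntegral f a y ∂ν ≤ c * ∫⁻ x, f x

variable [BorelSpace V] [FiniteDimensional ℝ V]

lemma HalfSegmentBound.mono {ν ν' : Measure V} {a : V} {c : ℝ≥0∞} (h : HalfSegmentBound ν a c)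
    (hν : ν' ≤ ν) : HalfSegmentBound ν' a c :=
  fun f hf => (lintegral_mono' hν le_rfl).trans (h f hf)

lemma halfSegmentBound_volume (a : V) :
    HalfSegmentBound volume a (2 ^ Module.finrank ℝ V) := by
  intro f hf
  simp only [halfSegmentLIntegral]
  rw [lintegral_lintegral_swap (by fun_prop)]
  calc ∫⁻ t in Icc (0 : ℝ) (1 / 2), ∫⁻ y, f (y + t • (a - y))
      ≤ ∫⁻ t in Icc (0 : ℝ) (1 / 2), 2 ^ Module.finrank ℝ V * ∫⁻ x, f x := by
        refine setLIntegral_mono' measurableSet_Icc fun t ht => ?_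
        refine le_trans (lintegral_congr fun y => ?_).le
          (lintegral_comp_smul_add_le volume f (show 1 / 2 ≤ 1 - t by linarith [ht.2]) (t • a))
        congr 1
        module
    _ ≤ 2 ^ Module.finrank ℝ V * ∫⁻ x, f x := by
        rw [setLIntegral_const, Real.volume_Icc]
        exact mul_le_of_le_one_right' (ENNReal.ofReal_le_one.2 (by norm_num))

lemma lintegral_halfSegmentLIntegral_hyperplane_le {f : V → ℝ≥0∞} (hf : Measurable f) (q : V)
    {n : V} (hn : ‖n‖ = 1) {a : V} {s : ℝ} (hs : 0 < s) (ha : s ≤ |inner ℝ n (a - q)|) :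
    ∫⁻ y : (ℝ ∙ n)ᗮ, halfSegmentLIntegral f a (y + q)
      ≤ 2 ^ Module.finrank ℝ V * ENNReal.ofReal s⁻¹ * ∫⁻ x, f x := by
  obtain ⟨b, hb⟩ := exists_hyperplaneCoord_eq q hn a
  set α : ℝ := inner ℝ n (a - q)
  have hα : α ≠ 0 := abs_pos.1 (hs.trans_le ha)
  have hcoord := measurePreserving_hyperplaneCoord q hn
  set slice : ℝ → ℝ≥0∞ := fun τ => ∫⁻ y, f (hyperplaneCoord q n (τ, y))
  have hfubini : ∫⁻ τ, slice τ = ∫⁻ x, f x := by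
    rw [← hcoord.lintegral_comp hf]
    exact (lintegral_prod _ (hf.comp hcoord.measurable).aemeasurable).symm
  simp only [halfSegmentLIntegral]
  rw [lintegral_lintegral_swap (by fun_prop)]
  calc ∫⁻ t in Icc (0 : ℝ) (1 / 2), ∫⁻ y : (ℝ ∙ n)ᗮ, f (y + q + t • (a - (y + q)))
      ≤ ∫⁻ t in Icc (0 : ℝ) (1 / 2), 2 ^ Module.finrank ℝ V * slice (α • t + 0) := by
        refine setLIntegral_mono' measurableSet_Icc fun t ht => ?_
        have hpoint (y : (ℝ ∙ n)ᗮ) : (y : V) + q + t • (a - (y + q))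
            = hyperplaneCoord q n (α • t + 0, (1 - t) • y + t • b) := by
          rw [← hb]
          simp only [hyperplaneCoord, Submodule.coe_add, Submodule.coe_smul, smul_eq_mul]
          module
        simp_rw [hpoint]
        refine (lintegral_comp_smul_add_le volume (fun y => f (hyperplaneCoord q n (α • t + 0, y)))
          (show 1 / 2 ≤ 1 - t by linarith [ht.2]) _).trans ?_
        gcongr
        · exact one_le_two
        · exact Submodule.finrank_le _
    _ ≤ ∫⁻ t, 2 ^ Module.finrank ℝ V * slice (α • t + 0) := setLIntegral_le_lintegral _ _
    _ = 2 ^ Module.finrank ℝ V * (ENNReal.ofReal |α⁻¹| * ∫⁻ x, f x) := by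
        rw [lintegral_const_mul' _ _ (by finiteness), lintegral_comp_smul_add volume _ hα, hfubini]
        simp
    _ ≤ 2 ^ Module.finrank ℝ V * ENNReal.ofReal s⁻¹ * ∫⁻ x, f x := by
        rw [mul_assoc, abs_inv]
        gcongr

end Segments

/-! ### The Poincaré inequality for smooth functions -/

lemma memLp_restrict_of_subset_isCompact {X G : Type*} [TopologicalSpace X] [MeasurableSpace X]
    [OpensMeasurableSpace X] [NormedAddCommGroup G] [SecondCountableTopologyEither X G]
    {μ : Measure X} {s K : Set X} [IsFiniteMeasure (μ.restrict s)] {f : X → G} (hf : Continuous f)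
    (hs : MeasurableSet s) (hK : IsCompact K) (hsK : s ⊆ K) (p : ℝ≥0∞) :
    MemLp f p (μ.restrict s) := by
  obtain ⟨C, hC⟩ := hK.exists_bound_of_continuousOn hf.continuousOn
  refine MemLp.of_bound hf.aestronglyMeasurable C ?_
  filter_upwards [ae_restrict_mem hs] with x hx using hC x (hsK hx)

section ConvexHull

variable {V : Type*} [NormedAddCommGroup V] [NormedSpace ℝ V] [FiniteDimensional ℝ V]
  [MeasurableSpace V] [BorelSpace V]

lemma restrict_closure_eq_restrict_interior (μ : Measure V) [μ.IsAddHaarMeasure] {D : Set V}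
    (hD : Convex ℝ D) : μ.restrict (closure D) = μ.restrict (interior D) :=
  Measure.restrict_congr_set
    ((closure_ae_eq_of_null_frontier (hD.addHaar_frontier μ)).trans
      (interior_ae_eq_of_null_frontier (hD.addHaar_frontier μ)).symm)

end ConvexHull

section Energy

variable {V : Type*} [NormedAddCommGroup V] [InnerProductSpace ℝ V] [FiniteDimensional ℝ V]
  [MeasurableSpace V] [BorelSpace V]

/-- The Dirichlet energy of `φ` on the convex hull of `K`, multiplied by the square of the
diameter of `K`. -/
def scaledEnergy (φ : V → ℝ) (K : Set V) : ℝ≥0∞ :=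
  Metric.ediam K ^ 2 * ∫⁻ z in interior (convexHull ℝ K), ‖gradient φ z‖ₑ ^ 2

variable {ν : Measure V} [SFinite ν] {A : Set V} {c : ℝ≥0∞}

lemma lintegral_add_halfSegmentLIntegral_le (hA : MeasurableSet A)
    (hc : ∀ a ∈ A, HalfSegmentBound ν a c) {f : V → ℝ≥0∞} (hf : Measurable f) :
    ∫⁻ a in A, ∫⁻ y, (halfSegmentLIntegral f a y + halfSegmentLIntegral f y a) ∂ν
      ≤ (c * volume A + 2 ^ Module.finrank ℝ V * ν univ) * ∫⁻ x, f x := by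
  have hm := measurable_halfSegmentLIntegral hf
  have hmA : Measurable fun a => ∫⁻ y, halfSegmentLIntegral f a y ∂ν := hm.lintegral_prod_right'
  calc ∫⁻ a in A, ∫⁻ y, (halfSegmentLIntegral f a y + halfSegmentLIntegral f y a) ∂ν
      = (∫⁻ a in A, ∫⁻ y, halfSegmentLIntegral f a y ∂ν)
          + ∫⁻ y, ∫⁻ a in A, halfSegmentLIntegral f y a ∂volume ∂ν := by
        rw [lintegral_lintegral_swap (μ := ν) hm.aemeasurable, ← lintegral_add_left hmA]
        exact lintegral_congr fun a => lintegral_add_left (hm.comp measurable_prodMk_left) _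
    _ ≤ (∫⁻ _ in A, c * ∫⁻ x, f x) + ∫⁻ _, 2 ^ Module.finrank ℝ V * (∫⁻ x, f x) ∂ν :=
        add_le_add (setLIntegral_mono' hA fun a ha => hc a ha f hf) (lintegral_mono fun y =>
          (halfSegmentBound_volume y).mono Measure.restrict_le_self f hf)
    _ = (c * volume A + 2 ^ Module.finrank ℝ V * ν univ) * ∫⁻ x, f x := by
        rw [setLIntegral_const, lintegral_const]
        ring

lemma sqOscillation_le_scaledEnergy {φ : V → ℝ} (hφ : ContDiff ℝ 1 φ) {K : Set V}
    (hA : MeasurableSet A) (hAK : A ⊆ K) (hν : ∀ᵐ y ∂ν, y ∈ K)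
    (hc : ∀ a ∈ A, HalfSegmentBound ν a c) :
    sqOscillation φ (volume.restrict A) ν
      ≤ (c * volume A + 2 ^ Module.finrank ℝ V * ν univ) * scaledEnergy φ K := by
  set D : Set V := closure (convexHull ℝ K)
  have hD : Convex ℝ D := (convex_convexHull ℝ K).closure
  have hDm : MeasurableSet D := isClosed_closure.measurableSet
  have hKD : K ⊆ D := (subset_convexHull ℝ K).trans subset_closure
  set f : V → ℝ≥0∞ := D.indicator fun z => ‖gradient φ z‖ₑ ^ 2
  have hf : Measurable f := by
    have := (hφ.continuous_fderiv one_ne_zero).measurable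
    simp only [f, enorm_gradient]
    exact (this.enorm.pow_const 2).indicator hDm
  have hm := measurable_halfSegmentLIntegral hf
  have hm' : Measurable fun p : V × V =>
      halfSegmentLIntegral f p.1 p.2 + halfSegmentLIntegral f p.2 p.1 :=
    hm.add (hm.comp measurable_swap)
  calc sqOscillation φ (volume.restrict A) ν
      ≤ ∫⁻ a in A, ∫⁻ y, Metric.ediam K ^ 2 *
          (halfSegmentLIntegral f a y + halfSegmentLIntegral f y a) ∂ν := by
        refine setLIntegral_mono' hA fun a ha => lintegral_mono_ae (hν.mono fun y hy => ?_)
        refine (enorm_sub_sq_le_halfSegmentLIntegral hφ hD (hKD (hAK ha)) (hKD hy)).trans ?_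
        gcongr
        rw [← edist_eq_enorm_sub]
        exact Metric.edist_le_ediam_of_mem (hAK ha) hy
    _ = Metric.ediam K ^ 2 *
          ∫⁻ a in A, ∫⁻ y, (halfSegmentLIntegral f a y + halfSegmentLIntegral f y a) ∂ν := by
        rw [← lintegral_const_mul _ hm'.lintegral_prod_right']
        exact lintegral_congr fun a => lintegral_const_mul _
          (hm'.comp measurable_prodMk_left)
    _ ≤ Metric.ediam K ^ 2 * ((c * volume A + 2 ^ Module.finrank ℝ V * ν univ) * ∫⁻ x, f x) := by
        gcongr
        exact lintegral_add_halfSegmentLIntegral_le hA hc hf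
    _ = (c * volume A + 2 ^ Module.finrank ℝ V * ν univ) * scaledEnergy φ K := by
        rw [lintegral_indicator hDm,
          restrict_closure_eq_restrict_interior volume (convex_convexHull ℝ K), scaledEnergy]
        ring

end Energy

section FlatBoundaryPart

variable {d : ℕ}

lemma halfSegmentBound_surfaceMeasure (q : E d) {n : E d} (hn : ‖n‖ = 1) {a : E d} {s : ℝ}
    (hs : 0 < s) (ha : s ≤ |inner ℝ n (a - q)|) :
    HalfSegmentBound ((surfaceMeasure d).restrict (hyperplane q n)) a
      (2 ^ d * ENNReal.ofReal s⁻¹) := by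
  intro f hf
  rw [← map_volume_hyperplane q hn,
    (isometry_coe_add q _).isClosedEmbedding.measurableEmbedding.lintegral_map]
  simpa using lintegral_halfSegmentLIntegral_hyperplane_le hf q hn hs ha

variable {K : Set (E d)} {q n : E d} {s : ℝ}

lemma volume_le_two_mul_volume_far (hK : IsCompact K) (hn : ‖n‖ = 1)
    (hs : 4 * (ENNReal.ofReal s * surfaceMeasure d (frontier K)) ≤ volume K) :
    volume K ≤ 2 * volume (K ∩ {x | s ≤ |inner ℝ n (x - q)|}) := by
  set A := K ∩ {x | s ≤ |inner ℝ n (x - q)|}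
  set b := surfaceMeasure d (frontier K)
  have hkt : volume K ≠ ⊤ := hK.measure_lt_top.ne
  have hcover : K ⊆ A ∪ K ∩ {x | |inner ℝ n (x - q)| < s} := fun x hx =>
    (le_or_gt s |inner ℝ n (x - q)|).imp (fun h => ⟨hx, h⟩) fun h => ⟨hx, h⟩
  have hslab : 2 * volume (K ∩ {x | |inner ℝ n (x - q)| < s}) ≤ volume K := by
    refine le_trans ?_ hs
    grw [volume_inter_slab_le hK q hn s, ENNReal.ofReal_mul zero_le_two, ENNReal.ofReal_ofNat]
    apply le_of_eq
    ring
  refine (ENNReal.add_le_add_iff_right hkt).1 ?_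
  calc volume K + volume K = 2 * volume K := (two_mul _).symm
    _ ≤ 2 * (volume A + volume (K ∩ {x | |inner ℝ n (x - q)| < s})) := by
        gcongr
        exact (measure_mono hcover).trans (measure_union_le _ _)
    _ ≤ 2 * volume A + volume K := by
        rw [mul_add]
        gcongr

lemma exists_pos_ofReal_mul_eq {k b : ℝ≥0∞} (hk : k ≠ 0) (hk' : k ≠ ⊤) (hb : b ≠ 0) (hb' : b ≠ ⊤) :
    ∃ s : ℝ, 0 < s ∧ 4 * (ENNReal.ofReal s * b) = k := by
  have hdiv : k / (4 * b) ≠ ⊤ := ENNReal.div_ne_top hk' (by simp [hb])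
  refine ⟨(k / (4 * b)).toReal, ENNReal.toReal_pos (by simp [hk]; finiteness) hdiv, ?_⟩
  rw [ENNReal.ofReal_toReal hdiv, mul_left_comm]
  exact ENNReal.div_mul_cancel (by simp [hb]) (by finiteness)

variable {φ : E d → ℝ} {F : Set (E d)}

lemma sqOscillation_far_le {A : Set (E d)} (hφ : ContDiff ℝ 1 φ) (hK : IsCompact K)
    (hA : MeasurableSet A) (hAK : A ⊆ K) (hAs : ∀ a ∈ A, s ≤ |inner ℝ n (a - q)|)
    (hF : MeasurableSet F) (hFK : F ⊆ frontier K) (hn : ‖n‖ = 1) (hFn : F ⊆ hyperplane q n)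
    (hs0 : 0 < s) (hb : surfaceMeasure d (frontier K) ≠ ⊤)
    (hs : volume K ≤ 4 * (ENNReal.ofReal s * surfaceMeasure d (frontier K))) :
    sqOscillation φ (volume.restrict A) ((surfaceMeasure d).restrict F)
      ≤ 5 * 2 ^ d * surfaceMeasure d (frontier K) * scaledEnergy φ K := by
  set b := surfaceMeasure d (frontier K)
  have : IsFiniteMeasure ((surfaceMeasure d).restrict F) :=
    isFiniteMeasure_restrict.2 (ne_top_of_le_ne_top hb (measure_mono hFK))
  refine (sqOscillation_le_scaledEnergy hφ hA hAK
    ((ae_restrict_mem hF).mono fun y hy => hK.isClosed.frontier_subset (hFK hy))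
    fun a ha => (halfSegmentBound_surfaceMeasure q hn hs0 (hAs a ha)).mono
      (Measure.restrict_mono hFn le_rfl)).trans ?_
  gcongr
  calc 2 ^ d * ENNReal.ofReal s⁻¹ * volume A
        + 2 ^ Module.finrank ℝ (E d) * (surfaceMeasure d).restrict F univ
      ≤ 2 ^ d * ENNReal.ofReal s⁻¹ * (4 * (ENNReal.ofReal s * b)) + 2 ^ d * b := by
        rw [finrank_euclideanSpace_fin, Measure.restrict_apply_univ]
        gcongr
        · exact (measure_mono hAK).trans hs
        · exact measure_mono hFK
    _ = (ENNReal.ofReal s⁻¹ * ENNReal.ofReal s) * (4 * 2 ^ d * b) + 2 ^ d * b := by ring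
    _ = 5 * 2 ^ d * b := by
        rw [← ENNReal.ofReal_mul (by positivity), inv_mul_cancel₀ hs0.ne', ENNReal.ofReal_one]
        ring

lemma sqOscillation_flat_le (hφ : ContDiff ℝ 1 φ) (hK : IsCompact K) (hK0 : volume K ≠ 0)
    (hb0 : surfaceMeasure d (frontier K) ≠ 0) (hb : surfaceMeasure d (frontier K) ≠ ⊤)
    (hF : MeasurableSet F) (hFK : F ⊆ frontier K) (hn : ‖n‖ = 1) (hFn : F ⊆ hyperplane q n) :
    sqOscillation φ (volume.restrict K) ((surfaceMeasure d).restrict F)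
      ≤ 28 * 2 ^ d * surfaceMeasure d (frontier K) * scaledEnergy φ K := by
  have hkt : volume K ≠ ⊤ := hK.measure_lt_top.ne
  obtain ⟨s, hs0, hs⟩ := exists_pos_ofReal_mul_eq hK0 hkt hb0 hb
  have hfar : volume K ≤ 2 * volume (K ∩ {x | s ≤ |inner ℝ n (x - q)|}) :=
    volume_le_two_mul_volume_far hK hn hs.le
  set A := K ∩ {x | s ≤ |inner ℝ n (x - q)|}
  set b := surfaceMeasure d (frontier K)
  have : IsFiniteMeasure ((surfaceMeasure d).restrict F) :=
    isFiniteMeasure_restrict.2 (ne_top_of_le_ne_top hb (measure_mono hFK))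
  have hA : MeasurableSet A :=
    hK.measurableSet.inter (isClosed_le continuous_const (by fun_prop)).measurableSet
  have hAF : sqOscillation φ (volume.restrict A) ((surfaceMeasure d).restrict F)
      ≤ 5 * 2 ^ d * b * scaledEnergy φ K :=
    sqOscillation_far_le hφ hK hA inter_subset_left (fun a ha => ha.2) hF hFK hn hFn hs0 hb hs.ge
  have hKA : sqOscillation φ (volume.restrict K) (volume.restrict A)
      ≤ (2 ^ d * volume K + 2 ^ d * volume K) * scaledEnergy φ K := by
    refine (sqOscillation_le_scaledEnergy hφ hK.measurableSet subset_rfl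
      ((ae_restrict_mem hA).mono fun y hy => hy.1)
      fun a _ => (halfSegmentBound_volume a).mono Measure.restrict_le_self).trans ?_
    rw [finrank_euclideanSpace_fin, Measure.restrict_apply_univ]
    gcongr
    exact inter_subset_left
  have htriangle := measure_univ_mul_sqOscillation_le hφ.continuous.measurable (volume.restrict K)
    ((surfaceMeasure d).restrict F) (volume.restrict A)
  simp only [Measure.restrict_apply_univ] at htriangle
  refine (ENNReal.mul_le_mul_iff_right hK0 hkt).1 ?_
  calc volume K * sqOscillation φ (volume.restrict K) ((surfaceMeasure d).restrict F)
      ≤ 2 * (volume A * sqOscillation φ (volume.restrict K) ((surfaceMeasure d).restrict F)) := by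
        rw [← mul_assoc]
        gcongr
    _ ≤ 2 * (2 * b * ((2 ^ d * volume K + 2 ^ d * volume K) * scaledEnergy φ K)
          + 2 * volume K * (5 * 2 ^ d * b * scaledEnergy φ K)) := by
        refine mul_le_mul_right (htriangle.trans ?_) _
        gcongr
        exact measure_mono hFK
    _ = volume K * (28 * 2 ^ d * b * scaledEnergy φ K) := by ring

end FlatBoundaryPart

section Geometry

variable {d k : ℕ} {S : Set (E d)}

lemma IsPolytopalRegion.isCompact (h : IsPolytopalRegion k S) : IsCompact S := by
  obtain ⟨P, rfl⟩ := h.finite_union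
  exact P.isCompact_biUnion fun s _ => s.finite_toSet.isCompact_convexHull ℝ

lemma IsPolytopalRegion.nonempty (h : IsPolytopalRegion k S) : S.Nonempty :=
  h.connected.nonempty.mono intrinsicInterior_subset

lemma IsPolytopalRegion.affineSpan_eq_top (h : IsPolytopalRegion d S) : affineSpan ℝ S = ⊤ := by
  rw [← AffineSubspace.direction_eq_top_iff_of_nonempty (h.nonempty.affineSpan ℝ)]
  exact Submodule.eq_top_of_finrank_eq (by rw [h.finrank_span, finrank_euclideanSpace_fin])

lemma IsPolytopalRegion.interior_nonempty (h : IsPolytopalRegion d S) : (interior S).Nonempty := by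
  obtain ⟨_, y, hy, rfl⟩ := h.connected.nonempty
  have hopen : IsOpen (affineSpan ℝ S : Set (E d)) := by
    rw [h.affineSpan_eq_top]
    exact isOpen_univ
  exact ⟨y, mem_interior.2 ⟨_, (image_mono interior_subset).trans (image_preimage_subset _ _),
    hopen.isOpenMap_subtype_val _ isOpen_interior, y, hy, rfl⟩⟩

lemma IsPolytopalRegion.exists_subset_hyperplane (h : IsPolytopalRegion k S) (hk : k < d) :
    ∃ q n : E d, ‖n‖ = 1 ∧ S ⊆ hyperplane q n := by
  obtain ⟨q, hq⟩ := h.nonempty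
  have hne : (affineSpan ℝ S).directionᗮ ≠ ⊥ := by
    intro h0
    have := (affineSpan ℝ S).direction.finrank_add_finrank_orthogonal
    rw [h0, h.finrank_span, finrank_bot, finrank_euclideanSpace_fin] at this
    omega
  obtain ⟨v, hv, hv0⟩ := Submodule.exists_mem_ne_zero_of_ne_bot hne
  refine ⟨q, (‖v‖⁻¹ : ℝ) • v, norm_smul_inv_norm hv0, fun x hx => ?_⟩
  have hmem : x - q ∈ (affineSpan ℝ S).direction :=
    AffineSubspace.vsub_mem_direction (subset_affineSpan ℝ S hx) (subset_affineSpan ℝ S hq)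
  rw [hyperplane, mem_ofPred_eq, inner_smul_left, Submodule.inner_left_of_mem_orthogonal hmem hv,
    mul_zero]

variable (K : Polytope d)

lemma Polytope.isCompact : IsCompact K.carrier := K.region.isCompact

lemma Polytope.volume_ne_zero : volume K.carrier ≠ 0 :=
  ((isOpen_interior.measure_pos volume K.region.interior_nonempty).trans_le
    (measure_mono interior_subset)).ne'

lemma Polytope.subset_frontier {F : Set (E d)} (hF : F ∈ K.faces) : F ⊆ frontier K.carrier := by
  rw [← K.iUnion_faces]
  exact subset_biUnion_of_mem (u := id) hF

lemma boundaryMeasure_univ : boundaryMeasure K univ = surfaceMeasure d (frontier K.carrier) :=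
  Measure.restrict_apply_univ _

lemma lintegral_boundaryMeasure_le (f : E d → ℝ≥0∞) :
    ∫⁻ x, f x ∂boundaryMeasure K ≤ ∑ F ∈ K.faces, ∫⁻ x in F, f x ∂surfaceMeasure d := by
  rw [boundaryMeasure, ← K.iUnion_faces, ← Finset.set_biUnion_coe, biUnion_eq_iUnion]
  refine (lintegral_mono' Measure.restrict_iUnion_le le_rfl).trans ?_
  rw [lintegral_sum_measure, tsum_fintype]
  exact (Finset.sum_coe_sort K.faces fun F => ∫⁻ x in F, f x ∂surfaceMeasure d).le

lemma restrict_carrier_le_restrict_hull : volume.restrict K.carrier ≤ volume.restrict (hull K) := by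
  rw [hull, ← restrict_closure_eq_restrict_interior volume (convex_convexHull ℝ K.carrier)]
  exact Measure.restrict_mono ((subset_convexHull ℝ _).trans subset_closure) le_rfl

lemma scaledEnergy_carrier (φ : E d → ℝ) :
    scaledEnergy φ K.carrier = (ENNReal.ofReal (Metric.diam K.carrier)
      * eLpNorm (gradient φ) 2 (volume.restrict (hull K))) ^ 2 := by
  rw [mul_pow, eLpNorm_two_sq, scaledEnergy, hull, Metric.diam,
    ENNReal.ofReal_toReal K.isCompact.isBounded.ediam_ne_top]

variable [NeZero d]

lemma Polytope.face_subset_hyperplane {F : Set (E d)} (hF : F ∈ K.faces) :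
    ∃ q n : E d, ‖n‖ = 1 ∧ F ⊆ hyperplane q n :=
  (K.face_region F hF).exists_subset_hyperplane (Nat.sub_lt (NeZero.pos d) one_pos)

lemma Polytope.surfaceMeasure_frontier_ne_top : surfaceMeasure d (frontier K.carrier) ≠ ⊤ := by
  rw [← K.iUnion_faces]
  refine ((measure_biUnion_finset_le _ _).trans_lt (ENNReal.sum_lt_top.2 fun F hF => ?_)).ne
  obtain ⟨q, n, hn, hFn⟩ := K.face_subset_hyperplane hF
  exact surfaceMeasure_lt_top_of_subset_hyperplane (K.face_region F hF).isCompact hn hFn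

instance : IsFiniteMeasure (boundaryMeasure K) :=
  ⟨by rw [boundaryMeasure_univ]; exact K.surfaceMeasure_frontier_ne_top.lt_top⟩

instance : NeZero (boundaryMeasure K) :=
  ⟨by
    rw [← Measure.measure_univ_ne_zero, boundaryMeasure_univ]
    exact surfaceMeasure_frontier_ne_zero K.isCompact K.volume_ne_zero⟩

lemma memLp_boundaryMeasure {φ : E d → ℝ} (hφ : Continuous φ) (p : ℝ≥0∞) :
    MemLp φ p (boundaryMeasure K) := by
  have : IsFiniteMeasure ((surfaceMeasure d).restrict (frontier K.carrier)) :=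
    inferInstanceAs (IsFiniteMeasure (boundaryMeasure K))
  exact memLp_restrict_of_subset_isCompact hφ isClosed_frontier.measurableSet K.isCompact
    K.isCompact.isClosed.frontier_subset p

end Geometry

section SmoothPoincare

variable {d : ℕ} [NeZero d] (K : Polytope d) {φ : E d → ℝ}

lemma sqOscillation_boundaryMeasure_le (hφ : ContDiff ℝ 1 φ) :
    sqOscillation φ (volume.restrict K.carrier) (boundaryMeasure K)
      ≤ K.faces.card * (28 * 2 ^ d * boundaryMeasure K univ * scaledEnergy φ K.carrier) := by
  have hφm := hφ.continuous.measurable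
  rw [sqOscillation_comm hφm, sqOscillation, ← nsmul_eq_mul]
  refine (lintegral_boundaryMeasure_le K _).trans (Finset.sum_le_card_nsmul _ _ _ fun F hF => ?_)
  obtain ⟨q, n, hn, hFn⟩ := K.face_subset_hyperplane hF
  have : IsFiniteMeasure ((surfaceMeasure d).restrict F) :=
    isFiniteMeasure_restrict.2 (ne_top_of_le_ne_top K.surfaceMeasure_frontier_ne_top
      (measure_mono (K.subset_frontier hF)))
  rw [← sqOscillation, sqOscillation_comm hφm, boundaryMeasure_univ]
  exact sqOscillation_flat_le hφ K.isCompact K.volume_ne_zero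
    (surfaceMeasure_frontier_ne_zero K.isCompact K.volume_ne_zero)
    K.surfaceMeasure_frontier_ne_top (K.face_region F hF).isCompact.measurableSet
    (K.subset_frontier hF) hn hFn

lemma eLpNorm_sub_average_le (hφ : ContDiff ℝ 1 φ) :
    eLpNorm (fun x => φ x - ⨍ y, φ y ∂boundaryMeasure K) 2 (volume.restrict K.carrier)
      ≤ ENNReal.ofReal ((K.faces.card * (28 * 2 ^ d) + 1) * Metric.diam K.carrier)
        * eLpNorm (gradient φ) 2 (volume.restrict (hull K)) := by
  set c : ℝ≥0∞ := K.faces.card * (28 * 2 ^ d)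
  have hc : ENNReal.ofReal (K.faces.card * (28 * 2 ^ d) + 1) = c + 1 := by
    rw [ENNReal.ofReal_add (by positivity) zero_le_one, ENNReal.ofReal_mul (by positivity),
      ENNReal.ofReal_mul (by positivity), ENNReal.ofReal_pow zero_le_two]
    simp [c]
  have hosc : ∫⁻ x in K.carrier, ‖φ x - ⨍ y, φ y ∂boundaryMeasure K‖ₑ ^ 2
      ≤ c * scaledEnergy φ K.carrier := by
    refine (ENNReal.mul_le_mul_iff_right (NeZero.ne (boundaryMeasure K univ))
      (measure_ne_top _ _)).1 ?_
    refine (measure_univ_mul_lintegral_sub_average_sq_le hφ.continuous.measurable _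
      ((memLp_boundaryMeasure K hφ.continuous 1).integrable le_rfl)).trans ?_
    refine (sqOscillation_boundaryMeasure_le K hφ).trans_eq ?_
    ring
  rw [← ENNReal.pow_le_pow_left_iff two_ne_zero, eLpNorm_two_sq,
    ENNReal.ofReal_mul (by positivity), hc, mul_assoc, mul_pow, ← scaledEnergy_carrier]
  refine hosc.trans ?_
  gcongr
  exact le_self_add.trans (le_self_pow le_add_self two_ne_zero)

lemma volume_mul_eLpNorm_boundaryMeasure_sq_le (hφ : ContDiff ℝ 1 φ) :
    volume K.carrier * eLpNorm φ 2 (boundaryMeasure K) ^ 2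
      ≤ 2 * boundaryMeasure K univ *
        (K.faces.card * (28 * 2 ^ d) * ENNReal.ofReal (Metric.diam K.carrier) ^ 2
            * eLpNorm (gradient φ) 2 (volume.restrict (hull K)) ^ 2
          + eLpNorm φ 2 (volume.restrict (hull K)) ^ 2) := by
  set β := boundaryMeasure K
  have hφm := hφ.continuous.measurable
  have hvolume : ∫⁻ z in K.carrier, ‖φ z‖ₑ ^ 2 ≤ eLpNorm φ 2 (volume.restrict (hull K)) ^ 2 := by
    rw [eLpNorm_two_sq]
    exact lintegral_mono' (restrict_carrier_le_restrict_hull K) le_rfl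
  calc volume K.carrier * eLpNorm φ 2 β ^ 2
      ≤ 2 * sqOscillation φ (volume.restrict K.carrier) β
        + 2 * β univ * ∫⁻ z in K.carrier, ‖φ z‖ₑ ^ 2 := by
        rw [eLpNorm_two_sq, sqOscillation_comm hφm, ← Measure.restrict_apply_univ]
        exact measure_univ_mul_lintegral_sq_le hφm _ β
    _ ≤ 2 * (K.faces.card * (28 * 2 ^ d * β univ * scaledEnergy φ K.carrier))
        + 2 * β univ * eLpNorm φ 2 (volume.restrict (hull K)) ^ 2 := by
        gcongr
        exact sqOscillation_boundaryMeasure_le K hφ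
    _ = _ := by
        rw [scaledEnergy_carrier]
        ring

lemma exists_eLpNorm_boundaryMeasure_le :
    ∃ A : ℝ≥0∞, A ≠ ⊤ ∧ ∀ φ : E d → ℝ, ContDiff ℝ 1 φ →
      eLpNorm φ 2 (boundaryMeasure K) ≤ A * (eLpNorm (gradient φ) 2 (volume.restrict (hull K))
        + eLpNorm φ 2 (volume.restrict (hull K))) := by
  set β := boundaryMeasure K
  set k := volume K.carrier
  set c : ℝ≥0∞ := K.faces.card * (28 * 2 ^ d) * ENNReal.ofReal (Metric.diam K.carrier) ^ 2
  have hk0 : k ≠ 0 := K.volume_ne_zero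
  refine ⟨2 * β univ * (c + 1) / k + 1, by finiteness, fun φ hφ => ?_⟩
  set x := eLpNorm (gradient φ) 2 (volume.restrict (hull K))
  set y := eLpNorm φ 2 (volume.restrict (hull K))
  have hmul : k * eLpNorm φ 2 β ^ 2 ≤ 2 * β univ * (c + 1) * (x + y) ^ 2 :=
    calc k * eLpNorm φ 2 β ^ 2 ≤ 2 * β univ * (c * x ^ 2 + 1 * y ^ 2) := by
          rw [one_mul]
          exact volume_mul_eLpNorm_boundaryMeasure_sq_le K hφ
      _ ≤ 2 * β univ * ((c + 1) * x ^ 2 + (c + 1) * y ^ 2) := by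
          gcongr
          · exact le_self_add
          · exact le_add_self
      _ ≤ 2 * β univ * ((c + 1) * (x + y) ^ 2) := by
          rw [← mul_add (c + 1)]
          gcongr
          exact pow_add_pow_le zero_le zero_le two_ne_zero
      _ = 2 * β univ * (c + 1) * (x + y) ^ 2 := (mul_assoc _ _ _).symm
  rw [← ENNReal.pow_le_pow_left_iff two_ne_zero, mul_pow]
  calc eLpNorm φ 2 β ^ 2 ≤ 2 * β univ * (c + 1) / k * (x + y) ^ 2 := by
        rw [← ENNReal.mul_div_right_comm,
          ENNReal.le_div_iff_mul_le (.inl hk0) (.inl K.isCompact.measure_lt_top.ne), mul_comm]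
        exact hmul
    _ ≤ (2 * β univ * (c + 1) / k + 1) ^ 2 * (x + y) ^ 2 := by
        gcongr
        exact le_self_add.trans (le_self_pow le_add_self two_ne_zero)

end SmoothPoincare

/-! ### Affine changes of variables and mollification in `L²` -/

lemma eLpNorm_two_le_iff {α G : Type*} [MeasurableSpace α] [NormedAddCommGroup G] {μ : Measure α}
    {f : α → G} {c : ℝ≥0∞} : eLpNorm f 2 μ ≤ c ↔ ∫⁻ x, ‖f x‖ₑ ^ 2 ∂μ ≤ c ^ 2 := by
  rw [← eLpNorm_two_sq]
  exact (ENNReal.pow_le_pow_left_iff two_ne_zero).symm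

lemma tendsto_eLpNorm_two_zero {α G ι : Type*} [MeasurableSpace α] [NormedAddCommGroup G]
    {μ : Measure α} {l : Filter ι} {f : ι → α → G}
    (h : Tendsto (fun i => ∫⁻ x, ‖f i x‖ₑ ^ 2 ∂μ) l (𝓝 0)) :
    Tendsto (fun i => eLpNorm (f i) 2 μ) l (𝓝 0) := by
  rw [ENNReal.tendsto_nhds_zero] at h ⊢
  intro ε hε
  filter_upwards [h (ε ^ 2) (ENNReal.pow_pos hε 2)] with i hi
  exact eLpNorm_two_le_iff.2 hi

section Dilation

variable {V G : Type*} [NormedAddCommGroup V] [NormedAddCommGroup G]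

lemma eventually_half_le_and_norm_le_one :
    ∀ᶠ p : ℝ × V in 𝓝 (1, 0), 1 / 2 ≤ p.1 ∧ ‖p.2‖ ≤ 1 := by
  have hdilation : ∀ᶠ p : ℝ × V in 𝓝 (1, 0), 1 / 2 < p.1 :=
    continuous_fst.continuousAt.eventually (lt_mem_nhds (by norm_num))
  have htranslation : ∀ᶠ p : ℝ × V in 𝓝 (1, 0), ‖p.2‖ < 1 :=
    continuous_snd.norm.continuousAt.eventually (gt_mem_nhds (by simp))
  filter_upwards [hdilation, htranslation] with p hp₁ hp₂ using ⟨hp₁.le, hp₂.le⟩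

lemma exists_forall_lt_norm_eq_zero {k : V → G} (hc : HasCompactSupport k) :
    ∃ R, 0 ≤ R ∧ ∀ x, R < ‖x‖ → k x = 0 := by
  obtain ⟨R, hR, hbound⟩ := hc.isCompact.isBounded.exists_pos_norm_le
  refine ⟨R, hR.le, fun x hx => ?_⟩
  contrapose! hx
  exact hbound x (subset_tsupport k hx)

variable [NormedSpace ℝ V]

lemma lt_norm_smul_add {R r : ℝ} (hr : 1 / 2 ≤ r) {b x : V} (hb : ‖b‖ ≤ 1)
    (hx : 2 * (R + 1) < ‖x‖) : R < ‖r • x + b‖ := by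
  have htriangle := norm_sub_le (r • x + b) b
  rw [add_sub_cancel_right, norm_smul, Real.norm_of_nonneg (by linarith)] at htriangle
  nlinarith [norm_nonneg x]

variable [FiniteDimensional ℝ V] [MeasurableSpace V] [BorelSpace V]
  {μ : Measure V} [μ.IsAddHaarMeasure]

lemma tendsto_eLpNorm_comp_smul_add_of_hasCompactSupport {k : V → G} (hk : Continuous k)
    (hc : HasCompactSupport k) :
    Tendsto (fun p : ℝ × V => eLpNorm (fun x => k (p.1 • x + p.2) - k x) 2 μ)
      (𝓝 (1, 0)) (𝓝 0) := by
  obtain ⟨C, hC⟩ := hc.exists_bound_of_continuous hk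
  obtain ⟨R, hR, hzero⟩ := exists_forall_lt_norm_eq_zero hc
  set B : Set V := Metric.closedBall 0 (2 * (R + 1))
  set F : ℝ × V → V → ℝ≥0∞ := fun p x => ‖k (p.1 • x + p.2) - k x‖ₑ ^ 2
  have hbound : ∀ᶠ p in 𝓝 (1, 0), ∀ᵐ x ∂μ,
      F p x ≤ B.indicator (fun _ => ENNReal.ofReal (C + C) ^ 2) x := by
    filter_upwards [eventually_half_le_and_norm_le_one] with p hp
    refine ae_of_all μ fun x => ?_
    by_cases hx : x ∈ B
    · rw [indicator_of_mem hx]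
      simp only [F, ← ofReal_norm]
      gcongr
      exact (norm_sub_le _ _).trans (add_le_add (hC _) (hC _))
    · rw [mem_closedBall_zero_iff, not_le] at hx
      simp [F, hzero x (by linarith), hzero _ (lt_norm_smul_add hp.1 hp.2 hx)]
  have hpointwise (x : V) : Tendsto (F · x) (𝓝 (1, 0)) (𝓝 0) := by
    have hcont : Continuous (F · x) := by fun_prop
    simpa [F] using hcont.tendsto (1, 0)
  apply tendsto_eLpNorm_two_zero
  rw [← lintegral_zero (μ := μ)]
  refine tendsto_lintegral_filter_of_dominated_convergence _
    (Eventually.of_forall fun p => Continuous.measurable (by fun_prop)) hbound ?_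
    (ae_of_all μ hpointwise)
  rw [lintegral_indicator_const Metric.isClosed_closedBall.measurableSet]
  exact ENNReal.mul_ne_top (by finiteness) measure_closedBall_lt_top.ne

lemma eLpNorm_comp_smul_add_le (f : V → G) {r : ℝ} (hr : 1 / 2 ≤ r) (b : V) :
    eLpNorm (fun x => f (r • x + b)) 2 μ ≤ 2 ^ Module.finrank ℝ V * eLpNorm f 2 μ := by
  rw [eLpNorm_two_le_iff, mul_pow, eLpNorm_two_sq]
  refine (lintegral_comp_smul_add_le μ (fun x => ‖f x‖ₑ ^ 2) hr b).trans ?_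
  exact mul_le_mul' (le_self_pow₀ (one_le_pow₀ one_le_two) two_ne_zero) le_rfl

lemma quasiMeasurePreserving_smul_add {r : ℝ} (hr : r ≠ 0) (b : V) :
    Measure.QuasiMeasurePreserving (fun x : V => r • x + b) μ μ :=
  (measurePreserving_add_right μ b).quasiMeasurePreserving.comp
    ⟨by fun_prop, (Measure.map_addHaar_smul μ hr).symm ▸ Measure.smul_absolutelyContinuous⟩

lemma tendsto_eLpNorm_comp_smul_add [NormedSpace ℝ G] {f : V → G} (hf : MemLp f 2 μ) :
    Tendsto (fun p : ℝ × V => eLpNorm (fun x => f (p.1 • x + p.2) - f x) 2 μ)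
      (𝓝 (1, 0)) (𝓝 0) := by
  rw [ENNReal.tendsto_nhds_zero]
  intro ε hε
  set c : ℝ≥0∞ := 2 ^ Module.finrank ℝ V + 2
  have hc : ε / c ≠ 0 := ENNReal.div_ne_zero.2 ⟨hε.ne', by finiteness⟩
  obtain ⟨k, hkc, hfk, hk, hkL⟩ := hf.exists_hasCompactSupport_eLpNorm_sub_le (by simp) hc
  filter_upwards [eventually_half_le_and_norm_le_one,
    ENNReal.tendsto_nhds_zero.1 (tendsto_eLpNorm_comp_smul_add_of_hasCompactSupport
      (μ := μ) hk hkc) (ε / c) (pos_iff_ne_zero.2 hc)] with p hp hpk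
  have hfkm := hf.1.sub hkL.1
  have hfkm' : AEStronglyMeasurable (fun x => (f - k) (p.1 • x + p.2)) μ :=
    hfkm.comp_quasiMeasurePreserving
      (quasiMeasurePreserving_smul_add (show p.1 ≠ 0 by linarith [hp.1]) p.2)
  have hkm : AEStronglyMeasurable (fun x => k (p.1 • x + p.2) - k x) μ :=
    Continuous.aestronglyMeasurable (by fun_prop)
  have hsplit : (fun x => f (p.1 • x + p.2) - f x)
      = (fun x => (f - k) (p.1 • x + p.2)) + (fun x => k (p.1 • x + p.2) - k x) - (f - k) := by
    ext x
    simp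
  calc eLpNorm (fun x => f (p.1 • x + p.2) - f x) 2 μ
      ≤ eLpNorm (fun x => (f - k) (p.1 • x + p.2)) 2 μ
        + eLpNorm (fun x => k (p.1 • x + p.2) - k x) 2 μ + eLpNorm (f - k) 2 μ := by
        rw [hsplit]
        grw [eLpNorm_sub_le (hfkm'.add hkm) hfkm one_le_two,
          eLpNorm_add_le hfkm' hkm one_le_two]
    _ ≤ 2 ^ Module.finrank ℝ V * (ε / c) + ε / c + ε / c := by
        grw [eLpNorm_comp_smul_add_le _ hp.1, hpk, hfk]
    _ = c * (ε / c) := by ring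
    _ ≤ ε := ENNReal.mul_div_le

end Dilation

section Mollify

variable {V G : Type*} [NormedAddCommGroup V] [NormedSpace ℝ V] [FiniteDimensional ℝ V]
  [MeasurableSpace V] [NormedAddCommGroup G] [NormedSpace ℝ G]
  (μ : Measure V) (ρ : ContDiffBump (0 : V))

/-- The mollification of `f`: its convolution with a normalised bump function. -/
def mollify (f : V → G) (p : V) : G := ∫ t, ρ.normed μ (p - t) • f t ∂μ

lemma mollify_eq_convolution (f : V → G) :
    mollify μ ρ f = convolution f (ρ.normed μ) (ContinuousLinearMap.lsmul ℝ ℝ).flip μ := rfl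

/-- The probability measure whose density is a normalised bump function. A mollification of `f` is
an average of translates of `f` with respect to it. -/
def bumpMeasure : Measure V := μ.withDensity fun z => ENNReal.ofReal (ρ.normed μ z)

variable [BorelSpace V]

lemma measurable_ofReal_normed : Measurable fun z => ENNReal.ofReal (ρ.normed μ z) :=
  ρ.continuous_normed.measurable.ennreal_ofReal

variable [μ.IsAddHaarMeasure]

lemma contDiff_mollify {f : V → G} (hf : LocallyIntegrable f μ) {k : ℕ∞} :
    ContDiff ℝ k (mollify μ ρ f) := by
  rw [mollify_eq_convolution]
  exact ρ.hasCompactSupport_normed.contDiff_convolution_right _ hf ρ.contDiff_normed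

lemma tsupport_normed_sub_subset (p : V) :
    tsupport (fun t => ρ.normed μ (p - t)) ⊆ Metric.closedBall p ρ.rOut := by
  refine closure_minimal (fun t ht => ?_) Metric.isClosed_closedBall
  have hball : p - t ∈ Metric.ball 0 ρ.rOut := by
    rw [← ρ.support_normed_eq (μ := μ)]
    exact ht
  rw [mem_ball_zero_iff, ← dist_eq_norm, dist_comm] at hball
  exact hball.le

instance : IsProbabilityMeasure (bumpMeasure μ ρ) :=
  ⟨by
    rw [bumpMeasure, withDensity_apply _ MeasurableSet.univ, Measure.restrict_univ,
      ← ofReal_integral_eq_lintegral_ofReal ρ.integrable_normed (ae_of_all μ ρ.nonneg_normed),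
      ρ.integral_normed, ENNReal.ofReal_one]⟩

lemma ae_bumpMeasure_norm_lt : ∀ᵐ z ∂bumpMeasure μ ρ, ‖z‖ < ρ.rOut := by
  rw [bumpMeasure, ae_withDensity_iff (measurable_ofReal_normed μ ρ)]
  refine ae_of_all μ fun z hz => ?_
  have hsupport : z ∈ Function.support (ρ.normed μ) := by
    intro h
    simp [h] at hz
  rwa [ρ.support_normed_eq, mem_ball_zero_iff] at hsupport

lemma mollify_eq_integral_bumpMeasure (f : V → G) (p : V) :
    mollify μ ρ f p = ∫ z, f (p - z) ∂bumpMeasure μ ρ := by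
  rw [bumpMeasure, integral_withDensity_eq_integral_toReal_smul (measurable_ofReal_normed μ ρ)
    (by simp), mollify, ← integral_sub_left_eq_self _ μ p]
  simp [ENNReal.toReal_ofReal (ρ.nonneg_normed _)]

lemma integrable_bumpMeasure {f : V → G} (hf : LocallyIntegrable f μ) (p : V) :
    Integrable (fun z => f (p - z)) (bumpMeasure μ ρ) := by
  rw [bumpMeasure, integrable_withDensity_iff_integrable_smul' (measurable_ofReal_normed μ ρ)
    (by simp)]
  have h : Integrable (fun t => ρ.normed μ (p - t) • f t) μ :=
    hf.integrable_smul_left_of_hasCompactSupport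
      (ρ.continuous_normed.comp (continuous_const.sub continuous_id))
      (ρ.hasCompactSupport_normed.comp_homeomorph (Homeomorph.subLeft p))
  simpa [ENNReal.toReal_ofReal (ρ.nonneg_normed _)] using h.comp_sub_left p

variable [CompleteSpace G]

lemma enorm_mollify_sub_sq_le {f : V → G} (hf : LocallyIntegrable f μ) (p : V) (c : G) :
    ‖mollify μ ρ f p - c‖ₑ ^ 2 ≤ ∫⁻ z, ‖f (p - z) - c‖ₑ ^ 2 ∂bumpMeasure μ ρ := by
  have hint := integrable_bumpMeasure μ ρ hf p
  have hmean : mollify μ ρ f p - c = ∫ z, (f (p - z) - c) ∂bumpMeasure μ ρ := by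
    rw [integral_sub hint (integrable_const _), mollify_eq_integral_bumpMeasure]
    simp
  rw [hmean]
  exact enorm_integral_sq_le (hint.1.sub aestronglyMeasurable_const)

lemma eLpNorm_mollify_comp_sub_le {f : V → G} (hfm : StronglyMeasurable f)
    (hf : LocallyIntegrable f μ) (r : ℝ) (b : V) {η : ℝ≥0∞}
    (h : ∀ z : V, ‖z‖ < ρ.rOut → eLpNorm (fun x => f (r • x + (b - z)) - f x) 2 μ ≤ η) :
    eLpNorm (fun x => mollify μ ρ f (r • x + b) - f x) 2 μ ≤ η := by
  have hmeas : Measurable fun q : V × V => ‖f (r • q.1 + b - q.2) - f q.1‖ₑ ^ 2 := by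
    have htranslates : StronglyMeasurable fun q : V × V => f (r • q.1 + b - q.2) :=
      hfm.comp_measurable (by fun_prop)
    exact (htranslates.sub (hfm.comp_measurable measurable_fst)).enorm.pow_const 2
  rw [eLpNorm_two_le_iff]
  calc ∫⁻ x, ‖mollify μ ρ f (r • x + b) - f x‖ₑ ^ 2 ∂μ
      ≤ ∫⁻ x, ∫⁻ z, ‖f (r • x + b - z) - f x‖ₑ ^ 2 ∂bumpMeasure μ ρ ∂μ :=
        lintegral_mono fun x => enorm_mollify_sub_sq_le μ ρ hf _ _
    _ = ∫⁻ z, ∫⁻ x, ‖f (r • x + b - z) - f x‖ₑ ^ 2 ∂μ ∂bumpMeasure μ ρ :=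
        lintegral_lintegral_swap hmeas.aemeasurable
    _ ≤ ∫⁻ _, η ^ 2 ∂bumpMeasure μ ρ := by
        refine lintegral_mono_ae ?_
        filter_upwards [ae_bumpMeasure_norm_lt μ ρ] with z hz
        simpa only [add_sub_assoc] using eLpNorm_two_le_iff.1 (h z hz)
    _ = η ^ 2 := by simp

end Mollify

section Gradient

variable {V : Type*} [NormedAddCommGroup V] [InnerProductSpace ℝ V] [CompleteSpace V]

lemma continuous_gradient {f : V → ℝ} (hf : ContDiff ℝ 1 f) : Continuous (gradient f) :=
  (LinearIsometryEquiv.continuous _).comp (hf.continuous_fderiv one_ne_zero)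

lemma gradient_sub {f f' : V → ℝ} (hf : Differentiable ℝ f) (hf' : Differentiable ℝ f') :
    gradient (f - f') = gradient f - gradient f' := by
  ext1 x
  rw [Pi.sub_apply, gradient, fderiv_sub (hf x) (hf' x), map_sub, gradient, gradient]

lemma gradient_comp_smul_add (f : V → ℝ) (r : ℝ) (b x : V) :
    gradient (fun x => f (r • x + b)) x = r • gradient f (r • x + b) := by
  rw [gradient, fderiv_comp_smul (f := fun y => f (y + b)), fderiv_comp_add_right, map_smul,
    gradient]

lemma gradient_comp_const_sub (f : V → ℝ) (p x : V) :
    gradient (fun x => f (p - x)) x = -gradient f (p - x) := by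
  simpa [neg_add_eq_sub] using gradient_comp_smul_add f (-1) p x

lemma hasCompactSupport_gradient {f : V → ℝ} (hf : HasCompactSupport f) :
    HasCompactSupport (gradient f) :=
  (hf.fderiv (𝕜 := ℝ)).comp_left (g := (InnerProductSpace.toDual ℝ V).symm) (map_zero _)

lemma gradient_eq_zero_of_notMem_tsupport {f : V → ℝ} {x : V} (hx : x ∉ tsupport f) :
    gradient f x = 0 := by
  rw [gradient, fderiv_of_notMem_tsupport ℝ hx, map_zero]

end Gradient

section GradientMollify

variable {V : Type*} [NormedAddCommGroup V] [InnerProductSpace ℝ V]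
  [FiniteDimensional ℝ V] [MeasurableSpace V] [BorelSpace V]
  (μ : Measure V) [μ.IsAddHaarMeasure] (ρ : ContDiffBump (0 : V))

lemma gradient_mollify_eq_integral {f : V → ℝ} (hf : LocallyIntegrable f μ) (p : V) :
    gradient (mollify μ ρ f) p = ∫ t, f t • gradient (ρ.normed μ) (p - t) ∂μ := by
  have hρ : ContDiff ℝ 1 (ρ.normed μ) := ρ.contDiff_normed
  have hρc : HasCompactSupport (ρ.normed μ) := ρ.hasCompactSupport_normed
  have hint := hf.integrable_smul_right_of_hasCompactSupport
    ((continuous_gradient hρ).comp (continuous_const.sub continuous_id))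
    ((hasCompactSupport_gradient hρc).comp_homeomorph (Homeomorph.subLeft p))
  refine ext_inner_left ℝ fun u => ?_
  rw [real_inner_comm, inner_gradient_left]
  refine Eq.trans ?_ (integral_inner hint u)
  rw [mollify_eq_convolution, (hρc.hasFDerivAt_convolution_right _ hf hρ p).fderiv,
    convolution_precompR_apply _ hf (hρc.fderiv (𝕜 := ℝ)) (hρ.continuous_fderiv one_ne_zero)]
  refine integral_congr_ae (ae_of_all μ fun t => ?_)
  simp [inner_smul_left, real_inner_comm _ u, inner_gradient_left, mul_comm]

end GradientMollify

/-! ### Density of smooth functions in `H¹` -/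

section WeakGradient

variable {d : ℕ} {Ω : Set (E d)} {v V : E d → ℝ} {g W : E d → E d}

lemma IsH1.integral_smul_gradient (hv : IsH1 Ω v g) (hVv : V =ᵐ[volume.restrict Ω] v)
    (hWg : W =ᵐ[volume.restrict Ω] g) {ψ : E d → ℝ} (hψ : ContDiff ℝ ((⊤ : ℕ∞) : WithTop ℕ∞) ψ)
    (hψc : HasCompactSupport ψ) (hψΩ : tsupport ψ ⊆ Ω) :
    ∫ t, V t • gradient ψ t = -∫ t, ψ t • W t := by
  have hleft : ∫ t in Ω, V t • gradient ψ t = ∫ t, V t • gradient ψ t :=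
    setIntegral_eq_integral_of_forall_compl_eq_zero fun t ht => by
      rw [gradient_eq_zero_of_notMem_tsupport (mt (@hψΩ t) ht), smul_zero]
  have hright : ∫ t in Ω, ψ t • W t = ∫ t, ψ t • W t :=
    setIntegral_eq_integral_of_forall_compl_eq_zero fun t ht => by
      rw [image_eq_zero_of_notMem_tsupport (mt (@hψΩ t) ht), zero_smul]
  calc ∫ t, V t • gradient ψ t = ∫ t in Ω, v t • gradient ψ t := by
        rw [← hleft]
        exact integral_congr_ae (hVv.mono fun t ht => by simp only [ht])
    _ = -∫ t in Ω, ψ t • g t := hv.weak_grad ψ hψ hψc hψΩ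
    _ = -∫ t, ψ t • W t := by
        rw [← hright]
        exact congrArg _ (integral_congr_ae (hWg.mono fun t ht => by simp only [ht])).symm

lemma IsH1.gradient_mollify (hv : IsH1 Ω v g) (ρ : ContDiffBump (0 : E d))
    (hV : LocallyIntegrable V volume) (hVv : V =ᵐ[volume.restrict Ω] v)
    (hWg : W =ᵐ[volume.restrict Ω] g) {p : E d} (hp : Metric.closedBall p ρ.rOut ⊆ Ω) :
    gradient (mollify volume ρ V) p = mollify volume ρ W p := by
  have hweak := hv.integral_smul_gradient hVv hWg
    (ρ.contDiff_normed.comp (contDiff_const.sub contDiff_id))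
    (ρ.hasCompactSupport_normed.comp_homeomorph (Homeomorph.subLeft p))
    ((tsupport_normed_sub_subset volume ρ p).trans hp)
  calc gradient (mollify volume ρ V) p
      = -∫ t, V t • gradient (fun t => ρ.normed volume (p - t)) t := by
        simp only [gradient_mollify_eq_integral volume ρ hV p, gradient_comp_const_sub, smul_neg,
          integral_neg, neg_neg]
    _ = mollify volume ρ W p := neg_eq_iff_eq_neg.2 hweak

end WeakGradient

section ContractedMollify

lemma ball_convexCombination_subset {V : Type*} [NormedAddCommGroup V] [NormedSpace ℝ V]
    {Ω : Set V} (hc : Convex ℝ Ω) {x₀ : V} {r t : ℝ} (hball : Metric.ball x₀ r ⊆ Ω) (ht : 0 < t)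
    (ht1 : t ≤ 1) {x : V} (hx : x ∈ Ω) :
    Metric.ball ((1 - t) • x + t • x₀) (t * r) ⊆ Ω := by
  intro y hy
  set e := y - ((1 - t) • x + t • x₀) with he
  have hmem : x₀ + t⁻¹ • e ∈ Ω := by
    apply hball
    rw [mem_ball_iff_norm, add_sub_cancel_left, norm_smul, norm_inv,
      Real.norm_of_nonneg ht.le, inv_mul_lt_iff₀ ht]
    exact mem_ball_iff_norm.1 hy
  have hcombination : y = (1 - t) • x + t • (x₀ + t⁻¹ • e) := by
    rw [smul_add, smul_inv_smul₀ ht.ne', he]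
    module
  rw [hcombination]
  exact hc hx hmem (sub_nonneg.2 ht1) ht.le (sub_add_cancel 1 t)

variable {V G : Type*} [NormedAddCommGroup V] [InnerProductSpace ℝ V]

/-- The bump function of radius `t r / 2`, with which functions are mollified at scale `t`. -/
def scaledBump {r t : ℝ} (hr : 0 < r) (ht : 0 < t) : ContDiffBump (0 : V) where
  rIn := t * r / 4
  rOut := t * r / 2
  rIn_pos := by positivity
  rIn_lt_rOut := by linarith [mul_pos ht hr]

variable [FiniteDimensional ℝ V] [MeasurableSpace V] [BorelSpace V] [NormedAddCommGroup G]
  [NormedSpace ℝ G] (x₀ : V) {r : ℝ} (hr : 0 < r)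

/-- The function `f` contracted towards `x₀` by the factor `1 - t` and mollified at scale `t`. The
radius `r` is that of a ball around `x₀` in the convex set on which `f` matters. -/
def contractedMollify {t : ℝ} (ht : 0 < t) (f : V → G) (x : V) : G :=
  mollify volume (scaledBump hr ht) f ((1 - t) • x + t • x₀)

lemma contDiff_contractedMollify {t : ℝ} (ht : 0 < t) {f : V → G}
    (hf : LocallyIntegrable f volume) {k : ℕ∞} :
    ContDiff ℝ k (contractedMollify x₀ hr ht f) :=
  (contDiff_mollify volume _ hf).comp ((contDiff_id.const_smul (1 - t)).add contDiff_const)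

lemma tendsto_eLpNorm_contractedMollify_sub [CompleteSpace G] {f : V → G}
    (hfm : StronglyMeasurable f) (hf : MemLp f 2 volume) {t : ℕ → ℝ} (ht : ∀ n, 0 < t n)
    (ht0 : Tendsto t atTop (𝓝 0)) :
    Tendsto (fun n => eLpNorm (contractedMollify x₀ hr (ht n) f - f) 2 volume) atTop (𝓝 0) := by
  rw [ENNReal.tendsto_nhds_zero]
  intro ε hε
  obtain ⟨δ, hδ, hclose⟩ := Metric.eventually_nhds_iff.1
    (ENNReal.tendsto_nhds_zero.1 (tendsto_eLpNorm_comp_smul_add hf) ε hε)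
  have hsmall : ∀ᶠ n in atTop, t n * (1 + ‖x₀‖ + r) < δ := by
    have h := ht0.mul_const (1 + ‖x₀‖ + r)
    rw [zero_mul] at h
    exact h.eventually (gt_mem_nhds hδ)
  filter_upwards [hsmall] with n hn
  refine eLpNorm_mollify_comp_sub_le volume _ hfm (hf.locallyIntegrable one_le_two) _ _
    fun z hz => ?_
  have htn := ht n
  have hx₀ := mul_nonneg htn.le (norm_nonneg x₀)
  have htr := mul_pos htn hr
  refine @hclose (1 - t n, t n • x₀ - z) ?_
  rw [Prod.dist_eq, max_lt_iff, dist_eq_norm, dist_eq_norm, sub_sub_cancel_left, norm_neg,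
    Real.norm_of_nonneg htn.le, sub_zero]
  refine ⟨by nlinarith, ?_⟩
  calc ‖t n • x₀ - z‖ ≤ t n * ‖x₀‖ + ‖z‖ := by
        simpa only [norm_smul, Real.norm_of_nonneg htn.le] using norm_sub_le (t n • x₀) z
    _ < t n * ‖x₀‖ + t n * r / 2 := by gcongr; exact hz
    _ < δ := by nlinarith

end ContractedMollify

lemma exists_stronglyMeasurable_extension {α G : Type*} [MeasurableSpace α] [NormedAddCommGroup G]
    {μ : Measure α} {p : ℝ≥0∞} {Ω : Set α} (hΩ : MeasurableSet Ω) {f : α → G}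
    (hf : MemLp f p (μ.restrict Ω)) :
    ∃ F : α → G, StronglyMeasurable F ∧ MemLp F p μ ∧ F =ᵐ[μ.restrict Ω] f := by
  have h : MemLp (Ω.indicator f) p μ := (memLp_indicator_iff_restrict hΩ).2 hf
  refine ⟨h.1.mk _, h.1.stronglyMeasurable_mk, h.ae_eq h.1.ae_eq_mk, ?_⟩
  exact (EventuallyEq.symm (ae_restrict_of_ae h.1.ae_eq_mk)).trans (indicator_ae_eq_restrict hΩ)

section Density

variable {d : ℕ} {Ω : Set (E d)} {v V : E d → ℝ} {g W : E d → E d}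

lemma IsH1.gradient_contractedMollify (hv : IsH1 Ω v g) (hc : Convex ℝ Ω)
    (hV : LocallyIntegrable V volume) (hVv : V =ᵐ[volume.restrict Ω] v)
    (hWg : W =ᵐ[volume.restrict Ω] g) {x₀ : E d} {r t : ℝ} (hr : 0 < r)
    (hball : Metric.ball x₀ r ⊆ Ω) (ht : 0 < t) (ht1 : t ≤ 1) {x : E d} (hx : x ∈ Ω) :
    gradient (contractedMollify x₀ hr ht V) x = (1 - t) • contractedMollify x₀ hr ht W x := by
  have hsub : Metric.closedBall ((1 - t) • x + t • x₀) (scaledBump (V := E d) hr ht).rOut ⊆ Ω :=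
    (Metric.closedBall_subset_ball (half_lt_self (mul_pos ht hr))).trans
      (ball_convexCombination_subset hc hball ht ht1 hx)
  exact (gradient_comp_smul_add _ _ _ x).trans
    (congrArg _ (hv.gradient_mollify _ hV hVv hWg hsub))

lemma eLpNorm_smul_sub_le {α G : Type*} [MeasurableSpace α] [NormedAddCommGroup G]
    [NormedSpace ℝ G] {μ : Measure α} {p : ℝ≥0∞} (hp : 1 ≤ p) {f h : α → G}
    (hf : AEStronglyMeasurable f μ) (hh : AEStronglyMeasurable h μ) {t : ℝ} (ht : 0 ≤ t)
    (ht1 : t ≤ 1) :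
    eLpNorm ((1 - t) • f - h) p μ ≤ eLpNorm (f - h) p μ + ENNReal.ofReal t * eLpNorm h p μ := by
  have hsplit : (1 - t) • f - h = (1 - t) • (f - h) - t • h := by module
  rw [hsplit]
  refine (eLpNorm_sub_le ((hf.sub hh).const_smul _) (hh.const_smul _) hp).trans ?_
  rw [eLpNorm_const_smul, eLpNorm_const_smul, Real.enorm_of_nonneg ht,
    Real.enorm_of_nonneg (sub_nonneg.2 ht1)]
  gcongr
  exact mul_le_of_le_one_left' (ENNReal.ofReal_le_one.2 (sub_le_self 1 ht))

lemma IsH1.exists_contDiff_tendsto (hv : IsH1 Ω v g) (hΩ : IsOpen Ω) (hc : Convex ℝ Ω)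
    (hne : Ω.Nonempty) :
    ∃ φ : ℕ → E d → ℝ, (∀ n, ContDiff ℝ ((⊤ : ℕ∞) : WithTop ℕ∞) (φ n)) ∧
      Tendsto (fun n => eLpNorm (φ n - v) 2 (volume.restrict Ω)) atTop (𝓝 0) ∧
      Tendsto (fun n => eLpNorm (gradient (φ n) - g) 2 (volume.restrict Ω)) atTop (𝓝 0) := by
  obtain ⟨x₀, hx₀⟩ := hne
  obtain ⟨r, hr, hball⟩ := Metric.isOpen_iff.1 hΩ x₀ hx₀
  obtain ⟨V, hVm, hVL, hVv⟩ := exists_stronglyMeasurable_extension hΩ.measurableSet hv.memLp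
  obtain ⟨W, hWm, hWL, hWg⟩ := exists_stronglyMeasurable_extension hΩ.measurableSet hv.memLp_grad
  have hV := hVL.locallyIntegrable one_le_two
  set t : ℕ → ℝ := fun n => 1 / ((n : ℝ) + 1)
  have ht (n : ℕ) : 0 < t n := Nat.one_div_pos_of_nat
  have ht1 (n : ℕ) : t n ≤ 1 := div_le_self zero_le_one (by simp)
  have ht0 : Tendsto t atTop (𝓝 0) := tendsto_one_div_add_atTop_nhds_zero_nat
  set φ : ℕ → E d → ℝ := fun n => contractedMollify x₀ hr (ht n) V
  set Φ : ℕ → E d → E d := fun n => contractedMollify x₀ hr (ht n) W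
  have hφ := tendsto_eLpNorm_contractedMollify_sub x₀ hr hVm hVL ht ht0
  have hΦ : Tendsto (fun n => eLpNorm (Φ n - W) 2 volume
      + ENNReal.ofReal (t n) * eLpNorm W 2 volume) atTop (𝓝 0) := by
    simpa using (tendsto_eLpNorm_contractedMollify_sub x₀ hr hWm hWL ht ht0).add
      (ENNReal.Tendsto.mul_const (ENNReal.tendsto_ofReal ht0) (.inr hWL.eLpNorm_ne_top))
  refine ⟨φ, fun n => contDiff_contractedMollify x₀ hr (ht n) hV,
    tendsto_of_tendsto_of_tendsto_of_le_of_le tendsto_const_nhds hφ (fun _ => zero_le) fun n => ?_,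
    tendsto_of_tendsto_of_tendsto_of_le_of_le tendsto_const_nhds hΦ (fun _ => zero_le) fun n => ?_⟩
  · rw [eLpNorm_congr_ae (EventuallyEq.rfl.sub hVv.symm)]
    exact eLpNorm_restrict_le _ _ _ _
  · have hgrad : gradient (φ n) =ᵐ[volume.restrict Ω] (1 - t n) • Φ n := by
      filter_upwards [ae_restrict_mem hΩ.measurableSet] with x hx
      exact hv.gradient_contractedMollify hc hV hVv hWg hr hball (ht n) (ht1 n) hx
    rw [eLpNorm_congr_ae (hgrad.sub hWg.symm)]
    refine (eLpNorm_restrict_le _ _ _ _).trans (eLpNorm_smul_sub_le one_le_two ?_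
      hWm.aestronglyMeasurable (ht n).le (ht1 n))
    exact (contDiff_contractedMollify x₀ hr (ht n) (hWL.locallyIntegrable one_le_two)
      (k := 0)).continuous.aestronglyMeasurable

end Density

/-! ### Traces -/

section LpLimits

variable {α G ι : Type*} [MeasurableSpace α] [NormedAddCommGroup G] {μ : Measure α} {p : ℝ≥0∞}
  {l : Filter ι}

lemma exists_tendsto_eLpNorm_sub [CompleteSpace G] [Fact (1 ≤ p)] {f : ℕ → α → G}
    (hf : ∀ n, MemLp (f n) p μ) {c : ℕ → ℝ≥0∞} (hc : Tendsto c atTop (𝓝 0))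
    (h : ∀ m n, eLpNorm (f m - f n) p μ ≤ c m + c n) :
    ∃ w, MemLp w p μ ∧ Tendsto (fun n => eLpNorm (f n - w) p μ) atTop (𝓝 0) := by
  have hcauchy : CauchySeq fun n => (hf n).toLp (f n) := by
    rw [EMetric.cauchySeq_iff]
    intro ε hε
    obtain ⟨N, hN⟩ := eventually_atTop.1 (hc.eventually (gt_mem_nhds (ENNReal.half_pos hε.ne')))
    refine ⟨N, fun m hm n hn => ?_⟩
    rw [Lp.edist_toLp_toLp, ← ENNReal.add_halves ε]
    exact (h m n).trans_lt (ENNReal.add_lt_add (hN m hm) (hN n hn))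
  obtain ⟨w, hw⟩ := cauchySeq_tendsto_of_complete hcauchy
  refine ⟨w, Lp.memLp w, ?_⟩
  rw [← Lp.toLp_coeFn w (Lp.memLp w)] at hw
  exact (Lp.tendsto_Lp_iff_tendsto_eLpNorm'' _ hf _ (Lp.memLp w)).1 hw

lemma tendsto_eLpNorm_of_tendsto_eLpNorm_sub (hp : 1 ≤ p) {f : ι → α → G} {w : α → G}
    (hf : ∀ n, AEStronglyMeasurable (f n) μ) (hw : MemLp w p μ)
    (h : Tendsto (fun n => eLpNorm (f n - w) p μ) l (𝓝 0)) :
    Tendsto (fun n => eLpNorm (f n) p μ) l (𝓝 (eLpNorm w p μ)) := by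
  refine tendsto_of_tendsto_of_tendsto_of_le_of_le
    (g := fun n => eLpNorm w p μ - eLpNorm (f n - w) p μ)
    (h := fun n => eLpNorm (f n - w) p μ + eLpNorm w p μ) ?_ ?_ (fun n => ?_) fun n => ?_
  · simpa using ENNReal.Tendsto.sub tendsto_const_nhds h (.inl hw.eLpNorm_ne_top)
  · simpa using h.add_const (eLpNorm w p μ)
  · rw [tsub_le_iff_left, eLpNorm_sub_comm]
    simpa using eLpNorm_add_le (hw.1.sub (hf n)) (hf n) hp
  · simpa using eLpNorm_add_le ((hf n).sub hw.1) hw.1 hp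

lemma tendsto_average_of_tendsto_eLpNorm_sub [NormedSpace ℝ G] [IsFiniteMeasure μ] (hp : 1 ≤ p)
    {f : ι → α → G} {w : α → G} (hf : ∀ n, MemLp (f n) p μ) (hw : MemLp w p μ)
    (h : Tendsto (fun n => eLpNorm (f n - w) p μ) l (𝓝 0)) :
    Tendsto (fun n => ⨍ x, f n x ∂μ) l (𝓝 (⨍ x, w x ∂μ)) := by
  have hL1 : Tendsto (fun n => eLpNorm (f n - w) 1 μ) l (𝓝 0) := by
    refine tendsto_of_tendsto_of_tendsto_of_le_of_le tendsto_const_nhds ?_ (fun _ => zero_le)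
      fun n => eLpNorm_le_eLpNorm_mul_rpow_measure_univ hp ((hf n).1.sub hw.1)
    have hexp : 0 ≤ 1 / (1 : ℝ≥0∞).toReal - 1 / p.toReal := by
      rcases eq_or_ne p ⊤ with rfl | hp'
      · simp
      · have : 1 ≤ p.toReal := ENNReal.toReal_mono hp' hp
        simpa using inv_le_one_of_one_le₀ this
    simpa using ENNReal.Tendsto.mul_const h
      (.inr (ENNReal.rpow_ne_top_of_nonneg hexp (measure_ne_top μ univ)))
  simp only [average_eq]
  exact (tendsto_integral_of_L1' w hw.1 (.of_forall fun n => (hf n).integrable hp)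
    hL1).const_smul _

lemma tendsto_eLpNorm_sub_average [NormedSpace ℝ G] [IsFiniteMeasure μ] {ν : Measure α}
    [IsFiniteMeasure ν] (hp : 1 ≤ p) {f : ι → α → G} {v w : α → G} (hfμ : ∀ n, MemLp (f n) p μ)
    (hfν : ∀ n, MemLp (f n) p ν) (hv : MemLp v p μ) (hw : MemLp w p ν)
    (hμ : Tendsto (fun n => eLpNorm (f n - v) p μ) l (𝓝 0))
    (hν : Tendsto (fun n => eLpNorm (f n - w) p ν) l (𝓝 0)) :
    Tendsto (fun n => eLpNorm (fun x => f n x - ⨍ y, f n y ∂ν) p μ) l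
      (𝓝 (eLpNorm (fun x => v x - ⨍ y, w y ∂ν) p μ)) := by
  have havg := tendsto_average_of_tendsto_eLpNorm_sub hp hfν hw hν
  set b := ⨍ y, w y ∂ν
  set a : ι → G := fun n => ⨍ y, f n y ∂ν
  have hconst : Tendsto (fun n => μ univ ^ p.toReal⁻¹ * ‖a n - b‖ₑ) l (𝓝 0) := by
    simpa using ENNReal.Tendsto.const_mul (havg.sub_const b).enorm (.inr (by finiteness))
  refine tendsto_eLpNorm_of_tendsto_eLpNorm_sub hp
    (fun n => (hfμ n).1.sub aestronglyMeasurable_const) (hv.sub (memLp_const b)) ?_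
  refine tendsto_of_tendsto_of_tendsto_of_le_of_le tendsto_const_nhds
    (by simpa using hμ.add hconst) (fun _ => zero_le) fun n => ?_
  calc eLpNorm ((fun x => f n x - a n) - fun x => v x - b) p μ
      = eLpNorm ((f n - v) - fun _ => a n - b) p μ := by
        congr 1
        ext x
        exact sub_sub_sub_comm _ _ _ _
    _ ≤ eLpNorm (f n - v) p μ + eLpNorm (fun _ => a n - b) p μ :=
        eLpNorm_sub_le ((hfμ n).1.sub hv.1) aestronglyMeasurable_const hp
    _ ≤ eLpNorm (f n - v) p μ + μ univ ^ p.toReal⁻¹ * ‖a n - b‖ₑ := by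
        gcongr
        rw [← ofReal_norm]
        exact eLpNorm_le_of_ae_bound (ae_of_all μ fun _ => le_rfl)

end LpLimits

section Trace

variable {d : ℕ} (K : Polytope d) {v w : E d → ℝ} {g : E d → E d}

lemma isOpen_hull : IsOpen (hull K) := isOpen_interior

lemma convex_hull : Convex ℝ (hull K) := (convex_convexHull ℝ _).interior

lemma hull_nonempty : (hull K).Nonempty :=
  K.region.interior_nonempty.mono (interior_mono (subset_convexHull ℝ _))

variable [NeZero d]

lemma exists_isTrace (hv : IsH1 (hull K) v g) : ∃ w, IsTrace K v g w := by
  obtain ⟨φ, hφ, hφv, hφg⟩ := hv.exists_contDiff_tendsto (isOpen_hull K) (convex_hull K)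
    (hull_nonempty K)
  obtain ⟨A, hA, hbound⟩ := exists_eLpNorm_boundaryMeasure_le K
  have hφ1 (n : ℕ) : ContDiff ℝ 1 (φ n) := (hφ n).of_le (by simp)
  set ν := volume.restrict (hull K)
  have hφm (n : ℕ) : AEStronglyMeasurable (φ n - v) ν :=
    (hφ n).continuous.aestronglyMeasurable.sub hv.memLp.1
  have hgm (n : ℕ) : AEStronglyMeasurable (gradient (φ n) - g) ν :=
    (continuous_gradient (hφ1 n)).aestronglyMeasurable.sub hv.memLp_grad.1
  have hlim : Tendsto (fun n => A * (eLpNorm (gradient (φ n) - g) 2 ν + eLpNorm (φ n - v) 2 ν))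
      atTop (𝓝 0) := by
    simpa using ENNReal.Tendsto.const_mul (hφg.add hφv) (.inr hA)
  have hcauchy (m n : ℕ) : eLpNorm (φ m - φ n) 2 (boundaryMeasure K)
      ≤ A * (eLpNorm (gradient (φ m) - g) 2 ν + eLpNorm (φ m - v) 2 ν)
        + A * (eLpNorm (gradient (φ n) - g) 2 ν + eLpNorm (φ n - v) 2 ν) := by
    have hgrad : gradient (φ m - φ n) = (gradient (φ m) - g) - (gradient (φ n) - g) := by
      rw [sub_sub_sub_cancel_right, gradient_sub ((hφ1 m).differentiable one_ne_zero)
        ((hφ1 n).differentiable one_ne_zero)]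
    rw [← mul_add, add_add_add_comm]
    refine (hbound (φ m - φ n) ((hφ1 m).sub (hφ1 n))).trans ?_
    rw [hgrad]
    gcongr
    · exact eLpNorm_sub_le (hgm m) (hgm n) one_le_two
    · rw [← sub_sub_sub_cancel_right (φ m) (φ n) v]
      exact eLpNorm_sub_le (hφm m) (hφm n) one_le_two
  obtain ⟨w, hw, hφw⟩ := exists_tendsto_eLpNorm_sub (p := 2)
    (fun n => memLp_boundaryMeasure K (hφ n).continuous 2) hlim hcauchy
  exact ⟨w, hw, φ, hφ, hφv, hφg, hφw⟩

variable {K}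

lemma IsTrace.eLpNorm_sub_average_le (hw : IsTrace K v g w) (hv : IsH1 (hull K) v g) :
    eLpNorm (fun x => v x - ⨍ y, w y ∂boundaryMeasure K) 2 (volume.restrict K.carrier)
      ≤ ENNReal.ofReal ((K.faces.card * (28 * 2 ^ d) + 1) * Metric.diam K.carrier)
        * eLpNorm g 2 (volume.restrict (hull K)) := by
  obtain ⟨hwL, φ, hφ, hφv, hφg, hφw⟩ := hw
  have hφ1 (n : ℕ) : ContDiff ℝ 1 (φ n) := (hφ n).of_le (by simp)
  have hgrad := tendsto_eLpNorm_of_tendsto_eLpNorm_sub one_le_two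
    (fun n => (continuous_gradient (hφ1 n)).aestronglyMeasurable) hv.memLp_grad hφg
  have hμ := restrict_carrier_le_restrict_hull K
  have : IsFiniteMeasure (volume.restrict K.carrier) :=
    isFiniteMeasure_restrict.2 K.isCompact.measure_lt_top.ne
  have hdiff := tendsto_eLpNorm_sub_average one_le_two
    (fun n => memLp_restrict_of_subset_isCompact (hφ n).continuous
      K.isCompact.measurableSet K.isCompact Subset.rfl 2)
    (fun n => memLp_boundaryMeasure K (hφ n).continuous 2) (hv.memLp.mono_measure hμ) hwL
    (tendsto_of_tendsto_of_tendsto_of_le_of_le tendsto_const_nhds hφv (fun _ => zero_le)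
      fun n => eLpNorm_mono_measure _ hμ) hφw
  exact le_of_tendsto_of_tendsto' hdiff
    (ENNReal.Tendsto.const_mul hgrad (.inr ENNReal.ofReal_ne_top))
    fun n => Polytopal.eLpNorm_sub_average_le K (hφ1 n)

end Trace

end Polytopal

end

theorem lemma3p7_general (d : ℕ) [NeZero d] (N : ℕ) :
    ∃ C : ℝ, 0 < C ∧ ∀ K : Polytopal.Polytope d, K.faces.card ≤ N →
      ∀ (v : Polytopal.E d → ℝ) (g : Polytopal.E d → Polytopal.E d),
        Polytopal.IsH1 (Polytopal.hull K) v g →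
        (∃ w : Polytopal.E d → ℝ, Polytopal.IsTrace K v g w) ∧
        ∀ w : Polytopal.E d → ℝ, Polytopal.IsTrace K v g w →
          eLpNorm (fun x => v x - ⨍ y, w y ∂(Polytopal.boundaryMeasure K)) 2
              (volume.restrict K.carrier)
            ≤ ENNReal.ofReal (C * Metric.diam K.carrier) *
              eLpNorm g 2 (volume.restrict (Polytopal.hull K)) := by
  refine ⟨N * (28 * 2 ^ d) + 1, by positivity, fun K hN v g hv =>
    ⟨Polytopal.exists_isTrace K hv, fun w hw => (hw.eLpNorm_sub_average_le hv).trans ?_⟩⟩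
  gcongr

theorem lemma3p7 (d : ℕ) (hd : d = 2 ∨ d = 3) (N M : ℕ) (γ : ℝ) (hγ : 0 < γ) :
    ∃ C : ℝ, 0 < C ∧ ∀ K : Polytopal.Polytope d,
      K.faces.card ≤ N → Polytopal.HeightCondition K γ M →
      ∀ (v : Polytopal.E d → ℝ) (g : Polytopal.E d → Polytopal.E d),
        Polytopal.IsH1 (Polytopal.hull K) v g →
        (∃ w : Polytopal.E d → ℝ, Polytopal.IsTrace K v g w) ∧
        ∀ w : Polytopal.E d → ℝ, Polytopal.IsTrace K v g w →
          eLpNorm (fun x => v x - ⨍ y, w y ∂(Polytopal.boundaryMeasure K)) 2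
              (volume.restrict K.carrier)
            ≤ ENNReal.ofReal (C * Metric.diam K.carrier) *
              eLpNorm g 2 (volume.restrict (Polytopal.hull K)) := by
  have : NeZero d := ⟨by omega⟩
  obtain ⟨C, hC, h⟩ := lemma3p7_general d N
  exact ⟨C, hC, fun K hN _ => h K hN⟩
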